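/- Fix an integer $k\ge 2$. Let $\mathcal L_{\mathsf{BA}}=(0,S,+,V_k,\le)$, write $\underline n=S(\dots S(0)\dots)$ and $nt=t+(t+\dots+(t+0)\dots)$ ($n$ times), and read $x<y$ as $x\le y\wedge\neg\, y\le x$. A formula is $\Delta_0$ if all its quantifiers have the form $\exists x\le t$ or $\forall x\le t$ with $x$ not occurring in the term $t$. Put $$P_k(d):\ d>0\wedge V_k(d)=d,\qquad x\equiv_k y:\ \exists z\le x+y\,(x=y+kz\vee y=x+kz),$$ $$(x)_d=a:\ P_k(d)\wedge\exists y<d\,\exists z\le x\,\big(x=y+ad+z\wedge(z=0\vee V_k(z)>d)\big)\quad(0\le a<k).$$ The theory $\mathsf T_k$ consists of the universal closures of: the axioms of discretely ordered commutative cancellative monoids ($+$ is associative, commutative and cancellative with neutral element $0$; $\le$ is a linear order with $x\le y\to x+z\le y+z$; $S(x)=x+\underline 1$; $x<y\leftrightarrow S(x)\le y$); $x\ge 0$; $x\le y\leftrightarrow\exists z\le y\,(z+x=y)$; $\bigvee_{a<k}x\equiv_k\underline a$; $V_k(0)=0$; $V_k(\underline 1)=\underline 1$; $V_k(kx)=kV_k(x)$;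 $P_k(d)\to\bigwedge_{a=1}^{k-1}V_k(ad)=d$; $(x>0\wedge y>0\wedge V_k(x)<V_k(y))\to V_k(x+y)=V_k(x)$; $x>0\to\exists y\le x\bigvee_{a=1}^{k-1}\big(x=y+aV_k(x)\wedge(V_k(y)>V_k(x)\vee y=0)\big)$; $x>0\to\exists d\le x\,(P_k(d)\wedge d\le x<kd)$; $V_k(V_k(x))=V_k(x)$; and, for every $\Delta_0$-formula $\varphi(d,\bar y)$, comprehension $$P_k(d)\to\exists x<d\,\forall d'<d\,\Big(P_k(d')\to\big((x)_{d'}=1\wedge\varphi(d',\bar y)\big)\vee\big((x)_{d'}=0\wedge\neg\varphi(d',\bar y)\big)\Big).$$ Let $\Sigma_k=\{0,\dots,k-1\}$. For a DFA $A=(\Sigma_k^m,Q,q_0,F,\Delta)$, where $\Delta$ is the graph of a total function $Q\times\Sigma_k^m\to Q$, and $q_1\in Q$, let $W_{A,q_1}(x_1,\dots,x_m,d)$ be the $\Delta_0$-formula $$P_k(d)\wedge\exists (w_q)_{q\in Q}<kd\ \Big(\forall d'\le d\,\big(P_k(d')\to\bigvee_{q}\big((w_q)_{d'}=1\wedge\bigwedge_{q'\ne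 q}(w_{q'})_{d'}=0\big)\big)\wedge(w_{q_0})_{\underline 1}=1\wedge(w_{q_1})_d=1$$ $$\wedge\ \forall d'<d\,\big(P_k(d')\to\bigwedge_{q}\big((w_q)_{d'}=1\to\bigvee_{(q,\bar a,q')\in\Delta}\big((w_{q'})_{kd'}=1\wedge\bigwedge_{i=1}^m(x_i)_{d'}=a_i\big)\big)\big)\Big),$$ which says that $A$, reading the first $\log_k d$ base-$k$ digits of $\bar x$ (least significant first), reaches the state $q_1$. Let $g(\bar x)$ be the least power of $k$ greater than every $x_i$; its graph $g(\bar x)=d$ is defined by $$\Big(\bigwedge_{i}x_i=0\wedge d=\underline 1\Big)\vee\Big(P_k(d)\wedge\bigvee_{i}\big(\bigwedge_{j}x_i\ge x_j\wedge x_i<d\wedge d\le kx_i\big)\Big),$$ and $W_{A,q}(\bar x,g(\bar x))$ stands for $\exists d\le \underline 1+k(x_1+\dots+x_m)\,\big(g(\bar x)=d\wedge W_{A,q}(\bar x,d)\big)$. **Theorem.** For every $m\ge 0$ and every $\mathcal L_{\mathsf{BA}}$-formula $\varphi(\bar x)$ with free variables among $\bar x=(x_1,\dots,x_m)$ there is a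 DFA $A$ over $\Sigma_k^m$, with set of accepting states $F$, such that $$\mathsf T_k\vdash\forall\bar x\,\Big(\varphi(\bar x)\leftrightarrow\bigvee_{q\in F}W_{A,q}\big(\bar x,g(\bar x)\big)\Big),$$ where, for a sentence $\sigma$, $\mathsf T_k\vdash\sigma$ means that $\sigma$ holds in every model of $\mathsf T_k$ (equivalently, by Gödel's completeness theorem, that $\sigma$ is derivable from $\mathsf T_k$). -/

import Mathlib

namespace BuchiArith

open FirstOrder FirstOrder.Language

/-! ### The language `(0, S, +, V, ≤)` of Büchi arithmetic -/

inductive Func : ℕ → Type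
  | zero : Func 0
  | succ : Func 1
  | add : Func 2
  | V : Func 1

inductive Rel : ℕ → Type
  | le : Rel 2

abbrev LBA : FirstOrder.Language.{0, 0} := ⟨Func, Rel⟩

/-- Mathlib's `Term.le` (`t ≤ u`) and `Term.lt` (`t ≤ u ∧ ¬ u ≤ t`) become available. -/
instance : LBA.IsOrdered := ⟨Rel.le⟩

section Terms

variable {β : Type}

def tZero : LBA.Term β := Constants.term (L := LBA) Func.zero

def tSucc (t : LBA.Term β) : LBA.Term β := Functions.apply₁ (L := LBA) Func.succ t

def tAdd (t u : LBA.Term β) : LBA.Term β := Functions.apply₂ (L := LBA) Func.add t u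

def tV (t : LBA.Term β) : LBA.Term β := Functions.apply₁ (L := LBA) Func.V t

/-- The numeral `S(S(… S(0) …))`. -/
def numeral : ℕ → LBA.Term β
  | 0 => tZero
  | n + 1 => tSucc (numeral n)

/-- The term `n t = t + (t + (… (t + 0) …))`. -/
def nMul : ℕ → LBA.Term β → LBA.Term β
  | 0, _ => tZero
  | n + 1, t => tAdd t (nMul n t)

/-- The term `t₀ + (t₁ + (… (tₘ₋₁ + 0) …))`. -/
def tSum : {m : ℕ} → (Fin m → LBA.Term β) → LBA.Term β
  | 0, _ => tZero
  | _ + 1, t => tAdd (t 0) (tSum fun i => t i.succ)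

end Terms

/-! ### Bounded quantifiers

A `LBA.BoundedFormula α n` has free variables in `α` and further variables indexed by `Fin n`;
quantifying over the last one of `n + 1` variables gives a formula with `n` variables. -/

section Bounded

variable {α : Type} {n : ℕ}

/-- The variable that the next quantifier binds. -/
def new : LBA.Term (α ⊕ Fin (n + 1)) := Term.var (Sum.inr (Fin.last n))

/-- The term `t`, read where one more variable is available (this variable does not occur in it). -/
def lift (t : LBA.Term (α ⊕ Fin n)) : LBA.Term (α ⊕ Fin (n + 1)) :=
  t.relabel (Sum.map id Fin.castSucc)

/-- The term `t`, read where `s` more variables are available. -/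
def liftN (s : ℕ) (t : LBA.Term (α ⊕ Fin n)) : LBA.Term (α ⊕ Fin (n + s)) :=
  t.relabel (Sum.map id (Fin.castAdd s))

/-- `∃ x ≤ t, φ`, where `x` does not occur in `t`. -/
def exLe (t : LBA.Term (α ⊕ Fin n)) (φ : LBA.BoundedFormula α (n + 1)) : LBA.BoundedFormula α n :=
  ∃' (Term.le new (lift t) ⊓ φ)

/-- `∀ x ≤ t, φ`, where `x` does not occur in `t`. -/
def allLe (t : LBA.Term (α ⊕ Fin n)) (φ : LBA.BoundedFormula α (n + 1)) : LBA.BoundedFormula α n :=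
  ∀' (Term.le new (lift t) ⟹ φ)

/-- `∃ x < t, φ`, as the bounded formula `∃ x ≤ t, (x < t ∧ φ)`. -/
def exLt (t : LBA.Term (α ⊕ Fin n)) (φ : LBA.BoundedFormula α (n + 1)) : LBA.BoundedFormula α n :=
  exLe t (Term.lt new (lift t) ⊓ φ)

/-- `∀ x < t, φ`, as the bounded formula `∀ x ≤ t, (x < t → φ)`. -/
def allLt (t : LBA.Term (α ⊕ Fin n)) (φ : LBA.BoundedFormula α (n + 1)) : LBA.BoundedFormula α n :=
  allLe t (Term.lt new (lift t) ⟹ φ)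

/-- The block `∃ w₀ < t, …, ∃ wₛ₋₁ < t, φ`; in `φ` the variable `wᵢ` has the index `n + i`. -/
def exsLt (t : LBA.Term (α ⊕ Fin n)) :
    (s : ℕ) → LBA.BoundedFormula α (n + s) → LBA.BoundedFormula α n
  | 0, φ => φ
  | s + 1, φ => exsLt t s (exLt (liftN s t) φ)

/-- The bounded formulas (`Δ₀`): every quantifier is of the form `∃ x ≤ t` or `∀ x ≤ t` with `x`
not occurring in `t`. (`⊥` and `→` are the primitive connectives; `¬`, `∧`, `∨` are built from
these.) -/
inductive IsDelta0 {α : Type} : {n : ℕ} → LBA.BoundedFormula α n → Prop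
  | falsum {n : ℕ} : IsDelta0 (BoundedFormula.falsum : LBA.BoundedFormula α n)
  | equal {n : ℕ} (t u : LBA.Term (α ⊕ Fin n)) : IsDelta0 (BoundedFormula.equal t u)
  | rel {n l : ℕ} (R : LBA.Relations l) (t : Fin l → LBA.Term (α ⊕ Fin n)) :
      IsDelta0 (BoundedFormula.rel R t)
  | imp {n : ℕ} {φ ψ : LBA.BoundedFormula α n} :
      IsDelta0 φ → IsDelta0 ψ → IsDelta0 (φ ⟹ ψ)
  | allLe {n : ℕ} (t : LBA.Term (α ⊕ Fin n)) {φ : LBA.BoundedFormula α (n + 1)} :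
      IsDelta0 φ → IsDelta0 (allLe t φ)
  | exLe {n : ℕ} (t : LBA.Term (α ⊕ Fin n)) {φ : LBA.BoundedFormula α (n + 1)} :
      IsDelta0 φ → IsDelta0 (exLe t φ)

end Bounded

/-! ### Powers of `k`, congruence, digits -/

section Digits

variable {α : Type} {n : ℕ}

/-- `P_k(d)`: `d > 0 ∧ V_k(d) = d`. -/
def isPow (d : LBA.Term (α ⊕ Fin n)) : LBA.BoundedFormula α n :=
  Term.lt tZero d ⊓ (tV d =' d)

/-- `x ≡_k y`: `∃ z ≤ x + y, (x = y + k z ∨ y = x + k z)`. -/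
def congrMod (k : ℕ) (x y : LBA.Term (α ⊕ Fin n)) : LBA.BoundedFormula α n :=
  exLe (tAdd x y)
    ((lift x =' tAdd (lift y) (nMul k new)) ⊔ (lift y =' tAdd (lift x) (nMul k new)))

/-- `(x)_d = a`:
`P_k(d) ∧ ∃ y < d, ∃ z ≤ x, (x = y + a d + z ∧ (z = 0 ∨ V_k(z) > d))`. -/
def digitEq (x d : LBA.Term (α ⊕ Fin n)) (a : ℕ) : LBA.BoundedFormula α n :=
  isPow d ⊓ exLt d (exLe (lift x)
    ((lift (lift x) =' tAdd (tAdd (lift new) (nMul a (lift (lift d)))) new) ⊓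
      ((new =' tZero) ⊔ Term.lt (lift (lift d)) (tV new))))

end Digits

/-! ### The theory `T_k` -/

section Theory

/-- The universal closure of a formula `ψ(x₀, …, xₙ₋₁)`. -/
def univClosure {n : ℕ} (ψ : LBA.Formula (Fin n)) : LBA.Sentence :=
  BoundedFormula.alls (BoundedFormula.relabel (Sum.inr : Fin n → Empty ⊕ Fin n) ψ)

/-- The free variable `xᵢ`. -/
def fv {α : Type} {n : ℕ} (i : α) : LBA.Term (α ⊕ Fin n) := Term.var (Sum.inl i)

/-- The instance of the comprehension scheme for `φ(d, y₀, …, yₚ₋₁)`, where `d` is the variable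
of index `0` and `yᵢ` that of index `i + 1`:
`P_k(d) → ∃ x < d, ∀ d' < d, (P_k(d') →
  ((x)_{d'} = 1 ∧ φ(d', y)) ∨ ((x)_{d'} = 0 ∧ ¬ φ(d', y)))`. -/
def compAxiom {p : ℕ} (φ : LBA.Formula (Fin (p + 1))) : LBA.Formula (Fin (p + 1)) :=
  let φ' : LBA.BoundedFormula (Fin (p + 1)) 2 :=
    BoundedFormula.relabel (Fin.cases (Sum.inr (1 : Fin 2)) fun i => Sum.inl i.succ) φ
  isPow (fv 0) ⟹ exLt (fv 0) (allLt (fv 0) (isPow new ⟹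
    ((digitEq (lift new) new 1 ⊓ φ') ⊔ (digitEq (lift new) new 0 ⊓ ∼φ'))))

/-- The formulas whose universal closures are the axioms of `T_k`. -/
inductive Axioms (k : ℕ) : {n : ℕ} → LBA.Formula (Fin n) → Prop
  /- Discretely ordered commutative cancellative monoids. -/
  | add_assoc : Axioms k (n := 3)
      (tAdd (tAdd (fv 0) (fv 1)) (fv 2) =' tAdd (fv 0) (tAdd (fv 1) (fv 2)))
  | add_comm : Axioms k (n := 2) (tAdd (fv 0) (fv 1) =' tAdd (fv 1) (fv 0))
  | add_zero : Axioms k (n := 1) (tAdd (fv 0) tZero =' fv 0)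
  | add_cancel : Axioms k (n := 3)
      ((tAdd (fv 0) (fv 2) =' tAdd (fv 1) (fv 2)) ⟹ (fv 0 =' fv 1))
  | le_refl : Axioms k (n := 1) (Term.le (fv 0) (fv 0))
  | le_trans : Axioms k (n := 3)
      (Term.le (fv 0) (fv 1) ⟹ Term.le (fv 1) (fv 2) ⟹ Term.le (fv 0) (fv 2))
  | le_antisymm : Axioms k (n := 2)
      (Term.le (fv 0) (fv 1) ⟹ Term.le (fv 1) (fv 0) ⟹ (fv 0 =' fv 1))
  | le_total : Axioms k (n := 2) (Term.le (fv 0) (fv 1) ⊔ Term.le (fv 1) (fv 0))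
  | add_le_add : Axioms k (n := 3)
      (Term.le (fv 0) (fv 1) ⟹ Term.le (tAdd (fv 0) (fv 2)) (tAdd (fv 1) (fv 2)))
  | succ_eq : Axioms k (n := 1) (tSucc (fv 0) =' tAdd (fv 0) (numeral 1))
  | discrete : Axioms k (n := 2)
      (Term.lt (fv 0) (fv 1) ⇔ Term.le (tSucc (fv 0)) (fv 1))
  /- `x ≥ 0` -/
  | ord0 : Axioms k (n := 1) (Term.le tZero (fv 0))
  /- `x ≤ y ↔ ∃ z ≤ y, z + x = y` -/
  | ord1 : Axioms k (n := 2)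
      (Term.le (fv 0) (fv 1) ⇔ exLe (fv 1) (tAdd new (fv 0) =' fv 1))
  /- `⋁_{a < k} x ≡_k a` -/
  | mod : Axioms k (n := 1)
      (BoundedFormula.iSup fun a : Fin k => congrMod k (fv 0) (numeral a))
  /- `V_k(0) = 0` and `V_k(1) = 1` -/
  | v0_zero : Axioms k (n := 0) (tV tZero =' tZero)
  | v0_one : Axioms k (n := 0) (tV (numeral 1) =' numeral 1)
  /- `V_k(k x) = k V_k(x)` and `P_k(d) → ⋀_{1 ≤ a < k} V_k(a d) = d` -/
  | v1_mul : Axioms k (n := 1) (tV (nMul k (fv 0)) =' nMul k (tV (fv 0)))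
  | v1_pow : Axioms k (n := 1) (isPow (fv 0) ⟹
      BoundedFormula.iInf fun a : {a : Fin k // 1 ≤ (a : ℕ)} => (tV (nMul a (fv 0)) =' fv 0))
  /- `(x > 0 ∧ y > 0 ∧ V_k(x) < V_k(y)) → V_k(x + y) = V_k(x)` -/
  | v2 : Axioms k (n := 2)
      ((Term.lt tZero (fv 0) ⊓ Term.lt tZero (fv 1) ⊓ Term.lt (tV (fv 0)) (tV (fv 1))) ⟹
        (tV (tAdd (fv 0) (fv 1)) =' tV (fv 0)))
  /- `x > 0 → ∃ y ≤ x, ⋁_{1 ≤ a < k} (x = y + a V_k(x) ∧ (V_k(y) > V_k(x) ∨ y = 0))` -/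
  | v3 : Axioms k (n := 1) (Term.lt tZero (fv 0) ⟹ exLe (fv 0)
      (BoundedFormula.iSup fun a : {a : Fin k // 1 ≤ (a : ℕ)} =>
        (fv 0 =' tAdd new (nMul a (tV (fv 0)))) ⊓
          (Term.lt (tV (fv 0)) (tV new) ⊔ (new =' tZero))))
  /- `x > 0 → ∃ d ≤ x, (P_k(d) ∧ d ≤ x ∧ x < k d)` -/
  | v4 : Axioms k (n := 1) (Term.lt tZero (fv 0) ⟹ exLe (fv 0)
      (isPow new ⊓ (Term.le new (fv 0) ⊓ Term.lt (fv 0) (nMul k new))))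
  /- `V_k(V_k(x)) = V_k(x)` -/
  | v5 : Axioms k (n := 1) (tV (tV (fv 0)) =' tV (fv 0))
  /- Comprehension for `Δ₀`-formulas. -/
  | comp {p : ℕ} (φ : LBA.Formula (Fin (p + 1))) (hφ : IsDelta0 φ) : Axioms k (compAxiom φ)

/-- The theory `T_k`. -/
def T (k : ℕ) : LBA.Theory :=
  {σ | ∃ (n : ℕ) (ψ : LBA.Formula (Fin n)), Axioms k ψ ∧ σ = univClosure ψ}

end Theory

/-! ### Runs of automata -/

section Automata

variable {α : Type} {n m : ℕ}

/-- The graph `g(x) = d` of the function sending `x` to the least power of `k` greater than all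
`xᵢ`:
`(⋀ᵢ xᵢ = 0 ∧ d = 1) ∨ (P_k(d) ∧ ⋁ᵢ (⋀ⱼ xᵢ ≥ xⱼ ∧ xᵢ < d ∧ d ≤ k xᵢ))`. -/
noncomputable def gEq (k : ℕ) (x : Fin m → LBA.Term (α ⊕ Fin n)) (d : LBA.Term (α ⊕ Fin n)) :
    LBA.BoundedFormula α n :=
  (BoundedFormula.iInf (fun i => x i =' tZero) ⊓ (d =' numeral 1)) ⊔
    (isPow d ⊓ BoundedFormula.iSup fun i =>
      BoundedFormula.iInf (fun j => Term.le (x j) (x i)) ⊓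
        (Term.lt (x i) d ⊓ Term.le d (nMul k (x i))))

variable {k : ℕ} {Q : Type} [Finite Q]

/-- The formula `W_{A,q₁}(x, d)`: reading the first `log_k d` digits of `x`, least significant digit
first, `A` reaches the state `q₁`. It reads
`P_k(d) ∧ ∃ (w_q)_{q ∈ Q} < k d,`
`(∀ d' ≤ d, P_k(d') → ⋁_q ((w_q)_{d'} = 1 ∧ ⋀_{q' ≠ q} (w_{q'})_{d'} = 0))`
`∧ (w_{q₀})_1 = 1 ∧ (w_{q₁})_d = 1`
`∧ (∀ d' < d, P_k(d') → ⋀_q ((w_q)_{d'} = 1 →`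
`⋁_{(q, a, q') ∈ Δ} ((w_{q'})_{k d'} = 1 ∧ ⋀ᵢ (xᵢ)_{d'} = aᵢ)))`,
the transitions from `q` being the triples `(q, a, A.step q a)`. -/
noncomputable def W (A : DFA (Fin m → Fin k) Q) (q₁ : Q)
    (x : Fin m → LBA.Term (α ⊕ Fin n)) (d : LBA.Term (α ⊕ Fin n)) : LBA.BoundedFormula α n :=
  let s := Nat.card Q
  let w : Q → LBA.Term (α ⊕ Fin (n + s)) := fun q =>
    Term.var (Sum.inr (Fin.natAdd n (Finite.equivFin Q q)))
  isPow d ⊓ exsLt (nMul k d) s (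
    allLe (liftN s d) (isPow new ⟹ BoundedFormula.iSup fun q : Q =>
      digitEq (lift (w q)) new 1 ⊓
        BoundedFormula.iInf fun q' : {q' : Q // q' ≠ q} => digitEq (lift (w q')) new 0) ⊓
    (digitEq (w A.start) (numeral 1) 1 ⊓ digitEq (w q₁) (liftN s d) 1) ⊓
    allLt (liftN s d) (isPow new ⟹ BoundedFormula.iInf fun q : Q =>
      digitEq (lift (w q)) new 1 ⟹ BoundedFormula.iSup fun a : Fin m → Fin k =>
        digitEq (lift (w (A.step q a))) (nMul k new) 1 ⊓
          BoundedFormula.iInf fun i : Fin m => digitEq (lift (liftN s (x i))) new (a i)))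

/-- The formula `W_{A,q}(x, g(x))`, where `g` is eliminated by a bounded quantifier:
`∃ d ≤ 1 + k (x₀ + ⋯ + xₘ₋₁), (g(x) = d ∧ W_{A,q}(x, d))`. -/
noncomputable def WAtG (A : DFA (Fin m → Fin k) Q) (q : Q) : LBA.Formula (Fin m) :=
  exLe (tAdd (numeral 1) (nMul k (tSum fun i : Fin m => fv i))) (gEq k fv new ⊓ W A q fv new)

end Automata

/-! ### `W_{A,q}(x, d)` and `W_{A,q}(x, g(x))` are `Δ₀`-formulas -/

section Delta0

variable {α : Type} {n : ℕ} {φ ψ : LBA.BoundedFormula α n}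

theorem IsDelta0.not (h : IsDelta0 φ) : IsDelta0 (∼φ) := .imp h .falsum

theorem IsDelta0.inf (h : IsDelta0 φ) (h' : IsDelta0 ψ) : IsDelta0 (φ ⊓ ψ) := (h.imp h'.not).not

theorem IsDelta0.sup (h : IsDelta0 φ) (h' : IsDelta0 ψ) : IsDelta0 (φ ⊔ ψ) := h.not.imp h'

theorem IsDelta0.iSup {β : Type} [Finite β] {f : β → LBA.BoundedFormula α n}
    (h : ∀ b, IsDelta0 (f b)) : IsDelta0 (BoundedFormula.iSup f) := by
  unfold BoundedFormula.iSup
  dsimp only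
  generalize (@Finset.univ β (Fintype.ofFinite β)).toList = l
  induction l with
  | nil => exact .falsum
  | cons a l ih => exact (h a).sup ih

theorem IsDelta0.iInf {β : Type} [Finite β] {f : β → LBA.BoundedFormula α n}
    (h : ∀ b, IsDelta0 (f b)) : IsDelta0 (BoundedFormula.iInf f) := by
  unfold BoundedFormula.iInf
  dsimp only
  generalize (@Finset.univ β (Fintype.ofFinite β)).toList = l
  induction l with
  | nil => exact .imp .falsum .falsum
  | cons a l ih => exact (h a).inf ih

theorem isDelta0_le (t u : LBA.Term (α ⊕ Fin n)) : IsDelta0 (Term.le t u) := .rel _ _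

theorem isDelta0_lt (t u : LBA.Term (α ⊕ Fin n)) : IsDelta0 (Term.lt t u) :=
  (isDelta0_le _ _).inf (isDelta0_le _ _).not

theorem IsDelta0.exLt (t : LBA.Term (α ⊕ Fin n)) {φ : LBA.BoundedFormula α (n + 1)}
    (h : IsDelta0 φ) : IsDelta0 (exLt t φ) := .exLe _ ((isDelta0_lt _ _).inf h)

theorem IsDelta0.allLt (t : LBA.Term (α ⊕ Fin n)) {φ : LBA.BoundedFormula α (n + 1)}
    (h : IsDelta0 φ) : IsDelta0 (allLt t φ) := .allLe _ ((isDelta0_lt _ _).imp h)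

theorem IsDelta0.exsLt (t : LBA.Term (α ⊕ Fin n)) :
    ∀ (s : ℕ) {φ : LBA.BoundedFormula α (n + s)}, IsDelta0 φ → IsDelta0 (exsLt t s φ)
  | 0, _, h => h
  | s + 1, _, h => IsDelta0.exsLt t s (h.exLt _)

theorem isDelta0_isPow (d : LBA.Term (α ⊕ Fin n)) : IsDelta0 (isPow d) :=
  (isDelta0_lt _ _).inf (.equal _ _)

theorem isDelta0_digitEq (x d : LBA.Term (α ⊕ Fin n)) (a : ℕ) : IsDelta0 (digitEq x d a) :=
  (isDelta0_isPow _).inf (.exLt _ (.exLe _ (.inf (.equal _ _) (.sup (.equal _ _)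
    (isDelta0_lt _ _)))))

theorem isDelta0_W {k m : ℕ} {Q : Type} [Finite Q] (A : DFA (Fin m → Fin k) Q) (q : Q)
    (x : Fin m → LBA.Term (α ⊕ Fin n)) (d : LBA.Term (α ⊕ Fin n)) : IsDelta0 (W A q x d) :=
  .inf (isDelta0_isPow _) (.exsLt _ _ (.inf (.inf
    (.allLe _ (.imp (isDelta0_isPow _) (.iSup fun _ => .inf (isDelta0_digitEq _ _ _)
      (.iInf fun _ => isDelta0_digitEq _ _ _))))
    (.inf (isDelta0_digitEq _ _ _) (isDelta0_digitEq _ _ _)))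
    (.allLt _ (.imp (isDelta0_isPow _) (.iInf fun _ => .imp (isDelta0_digitEq _ _ _)
      (.iSup fun _ => .inf (isDelta0_digitEq _ _ _) (.iInf fun _ => isDelta0_digitEq _ _ _)))))))

theorem isDelta0_WAtG {k m : ℕ} {Q : Type} [Finite Q] (A : DFA (Fin m → Fin k) Q) (q : Q) :
    IsDelta0 (WAtG A q) :=
  .exLe _ (.inf (.sup (.inf (.iInf fun _ => .equal _ _) (.equal _ _))
    (.inf (isDelta0_isPow _) (.iSup fun _ => .inf (.iInf fun _ => isDelta0_le _ _)
      (.inf (isDelta0_lt _ _) (isDelta0_le _ _))))) (isDelta0_W _ _ _ _))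

end Delta0

end BuchiArith

/-!
Every model `M` of `T_k` is a discretely ordered monoid (`Arith`, `exists_arith`) whose elements can
be treated as words over `{0, …, k - 1}`, possibly of nonstandard length. The elements `z` with
`z = 0` or `d ≤ V z` behave like the multiples of the power `d` of `k`; they are closed under sums
and differences (`Mult.add`, `Mult.of_add`), which makes digits unique. Comprehension gives, for a
bounded definable property `R` of powers of `k`, a number `x` whose digits mark the powers at which
`R` holds. Then `V x` is the least such power (`D0.exists_least`), so bounded definable properties
can be proved by induction along the powers of `k` (`pow_induction_Icc`).

By this induction, every number has a remainder modulo every power of `k` (`exists_div`) and hence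
a digit there, and an automaton `A` reading `x` is in exactly one state `st A x d` at each power `d`
(`exists_run`), although `d` may be nonstandard. Invariants of runs are also proved this way
(`st_induction`).

A relation is called recognizable (`Recog`) if one automaton decides it in all models, at every
power of `k` that exceeds the arguments. Recognizable relations are closed under implication
(`Recog.imp`, product automaton) and under existential quantification (`Recog.ex`, subset
automaton). For the latter the witness `y` may have nonstandardly many digits more than the other
arguments `x`. There the automaton reads only zeros for `x`; the set of states that can be reached
by finitely many such steps is closed under transitions, hence contains the states of the whole
nonstandard run (`reachable_of_le`), and an accepting state is already reached by a path of standard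
length, which is realized by an actual number (`exists_of_reachable`). The graphs of addition and of
`V_k` are recognized by explicit automata (`st_addDFA`, `st_valDFA`), and the other atomic relations
are definable from these. So every formula is recognizable (`recog_formula`). Since `g(x)` is a
power of `k` above all entries of `x`, evaluation there gives the result.
-/

namespace BuchiArith

open FirstOrder FirstOrder.Language

/-! ### Models of `T_k` as ordered monoids -/

/-- The operations of a structure for `LBA` that is a linearly ordered commutative monoid. The
successor is not recorded: it is `x ↦ x + 1`. -/
class Ops (M : Type) extends AddCommMonoid M, LinearOrder M, One M where
  /-- The interpretation of `V_k`. -/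
  V : M → M

open Ops

instance Ops.structure (M : Type) [Ops M] : LBA.Structure M where
  funMap {_} f v :=
    match f with
    | .zero => 0
    | .succ => v 0 + 1
    | .add => v 0 + v 1
    | .V => V (v 0)
  RelMap {_} r v :=
    match r with
    | .le => v 0 ≤ v 1

instance (M : Type) [Ops M] : LBA.OrderedStructure M := ⟨fun _ => Iff.rfl⟩

/-- `d` is a power of `k`: the meaning of `P_k(d)`. -/
def Pow {M : Type} [Ops M] (d : M) : Prop := 0 < d ∧ V d = d

/-- The digit of `x` at the power `d` of `k` is `a`. -/
def DigitEq {M : Type} [Ops M] (x d : M) (a : ℕ) : Prop :=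
  Pow d ∧ ∃ y < d, ∃ z ≤ x, x = y + a • d + z ∧ (z = 0 ∨ d < V z)

/-- The models of `T_k` for `2 ≤ k`, with the first axioms absorbed into Mathlib's classes of
ordered monoids. -/
class Arith (k : outParam ℕ) (M : Type) extends Ops M, IsOrderedCancelAddMonoid M,
    CanonicallyOrderedAdd M where
  two_le : 2 ≤ k
  lt_iff_succ_le : ∀ x y : M, x < y ↔ x + 1 ≤ y
  residue : ∀ x : M, ∃ a < k, ∃ z : M, x = a • (1 : M) + k • z ∨ a • (1 : M) = x + k • z
  V_zero : V (0 : M) = 0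
  V_one : V (1 : M) = 1
  V_mul : ∀ x : M, V (k • x) = k • V x
  V_digit : ∀ d : M, Pow d → ∀ a : ℕ, 1 ≤ a → a < k → V (a • d) = d
  V_add : ∀ x y : M, 0 < x → 0 < y → V x < V y → V (x + y) = V x
  V_split : ∀ x : M, 0 < x → ∃ (y : M) (a : ℕ), 1 ≤ a ∧ a < k ∧ x = y + a • V x ∧
    (V x < V y ∨ y = 0)
  V_log : ∀ x : M, 0 < x → ∃ d : M, Pow d ∧ d ≤ x ∧ x < k • d
  V_V : ∀ x : M, V (V x) = V x
  comp : ∀ (p : ℕ) (φ : LBA.Formula (Fin (p + 1))), IsDelta0 φ → ∀ (y : Fin p → M) (d : M),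
    Pow d → ∃ x < d, ∀ e < d, Pow e →
      (DigitEq x e 1 ∧ φ.Realize (Fin.cons e y : Fin (p + 1) → M)) ∨
      (DigitEq x e 0 ∧ ¬ φ.Realize (Fin.cons e y : Fin (p + 1) → M))

/-! ### Realization of the formulas in the definition of `T_k` -/

section Realize

variable {M : Type} [Ops M] {α : Type} {n : ℕ}

@[simp] theorem realize_tZero {v : α → M} : (tZero : LBA.Term α).realize v = 0 := rfl

@[simp] theorem realize_tSucc {v : α → M} {t : LBA.Term α} :
    (tSucc t).realize v = t.realize v + 1 := rfl

@[simp] theorem realize_tAdd {v : α → M} {t u : LBA.Term α} :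
    (tAdd t u).realize v = t.realize v + u.realize v := rfl

@[simp] theorem realize_tV {v : α → M} {t : LBA.Term α} :
    (tV t).realize v = V (t.realize v) := rfl

@[simp] theorem realize_numeral {v : α → M} (a : ℕ) :
    (numeral a : LBA.Term α).realize v = a • (1 : M) := by
  induction a with
  | zero => simp [numeral]
  | succ a ih => simp [numeral, ih, succ_nsmul]

@[simp] theorem realize_nMul {v : α → M} (a : ℕ) (t : LBA.Term α) :
    (nMul a t).realize v = a • t.realize v := by
  induction a with
  | zero => simp [nMul]
  | succ a ih => simp [nMul, ih, succ_nsmul']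

@[simp] theorem realize_tSum {v : α → M} {m : ℕ} (t : Fin m → LBA.Term α) :
    (tSum t).realize v = ∑ i, (t i).realize v := by
  induction m with
  | zero => simp [tSum]
  | succ m ih => simp [tSum, ih, Fin.sum_univ_succ]

@[simp] theorem realize_fv {v : α → M} {xs : Fin n → M} (a : α) :
    (fv a : LBA.Term (α ⊕ Fin n)).realize (Sum.elim v xs) = v a := rfl

@[simp] theorem realize_new {v : α → M} {xs : Fin n → M} (b : M) :
    (new : LBA.Term (α ⊕ Fin (n + 1))).realize (Sum.elim v (Fin.snoc xs b)) = b := by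
  simp [new]

@[simp] theorem realize_lift {v : α → M} {xs : Fin n → M} (b : M) (t : LBA.Term (α ⊕ Fin n)) :
    (lift t).realize (Sum.elim v (Fin.snoc xs b)) = t.realize (Sum.elim v xs) := by
  rw [lift, Term.realize_relabel]
  congr 1
  ext (i | i) <;> simp

@[simp] theorem realize_liftN {v : α → M} {xs : Fin n → M} {s : ℕ} (w : Fin s → M)
    (t : LBA.Term (α ⊕ Fin n)) :
    (liftN s t).realize (Sum.elim v (Fin.append xs w)) = t.realize (Sum.elim v xs) := by
  rw [liftN, Term.realize_relabel]
  congr 1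
  ext (i | i) <;> simp

variable {v : α → M} {xs : Fin n → M}

theorem realize_exLe {t : LBA.Term (α ⊕ Fin n)} {φ : LBA.BoundedFormula α (n + 1)} :
    (exLe t φ).Realize v xs ↔
      ∃ b ≤ t.realize (Sum.elim v xs), φ.Realize v (Fin.snoc xs b) := by
  simp [exLe, Term.realize_le]

theorem realize_allLe {t : LBA.Term (α ⊕ Fin n)} {φ : LBA.BoundedFormula α (n + 1)} :
    (allLe t φ).Realize v xs ↔
      ∀ b ≤ t.realize (Sum.elim v xs), φ.Realize v (Fin.snoc xs b) := by
  simp [allLe, Term.realize_le]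

theorem realize_exLt {t : LBA.Term (α ⊕ Fin n)} {φ : LBA.BoundedFormula α (n + 1)} :
    (exLt t φ).Realize v xs ↔
      ∃ b < t.realize (Sum.elim v xs), φ.Realize v (Fin.snoc xs b) := by
  simp only [exLt, realize_exLe, BoundedFormula.realize_inf, Term.realize_lt, realize_new,
    realize_lift]
  exact ⟨fun ⟨b, _, h⟩ => ⟨b, h⟩, fun ⟨b, h⟩ => ⟨b, h.1.le, h⟩⟩

theorem realize_allLt {t : LBA.Term (α ⊕ Fin n)} {φ : LBA.BoundedFormula α (n + 1)} :
    (allLt t φ).Realize v xs ↔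
      ∀ b < t.realize (Sum.elim v xs), φ.Realize v (Fin.snoc xs b) := by
  simp only [allLt, realize_allLe, BoundedFormula.realize_imp, Term.realize_lt, realize_new,
    realize_lift]
  exact ⟨fun h b hb => h b hb.le hb, fun h b _ hb => h b hb⟩

theorem realize_exsLt {t : LBA.Term (α ⊕ Fin n)} {s : ℕ} {φ : LBA.BoundedFormula α (n + s)} :
    (exsLt t s φ).Realize v xs ↔ ∃ w : Fin s → M, (∀ i, w i < t.realize (Sum.elim v xs)) ∧
      φ.Realize v (Fin.append xs w) := by
  induction s with
  | zero =>
    simp only [exsLt, Fin.forall_fin_zero, true_and]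
    refine ⟨fun h => ⟨Fin.elim0, ?_⟩, fun ⟨w, h⟩ => ?_⟩
    · rwa [Fin.append_elim0]
    · rw [Subsingleton.elim w Fin.elim0, Fin.append_elim0] at h
      exact h
  | succ s ih =>
    simp only [exsLt, ih, realize_exLt, realize_liftN]
    constructor
    · rintro ⟨w, hw, b, hb, h⟩
      refine ⟨Fin.snoc w b, fun i => ?_, ?_⟩
      · induction i using Fin.lastCases <;> simp [hb, hw]
      · rwa [← Fin.append_snoc] at h
    · rintro ⟨w, hw, h⟩
      refine ⟨Fin.init w, fun i => hw _, w (Fin.last s), hw _, ?_⟩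
      rwa [← Fin.append_snoc, Fin.snoc_init_self]

theorem realize_isPow {t : LBA.Term (α ⊕ Fin n)} :
    (isPow t).Realize v xs ↔ Pow (t.realize (Sum.elim v xs)) := by
  simp [isPow, Pow, Term.realize_lt]

theorem realize_digitEq {x d : LBA.Term (α ⊕ Fin n)} {a : ℕ} :
    (digitEq x d a).Realize v xs ↔
      DigitEq (x.realize (Sum.elim v xs)) (d.realize (Sum.elim v xs)) a := by
  simp [digitEq, DigitEq, realize_isPow, realize_exLt, realize_exLe, Term.realize_lt]

end Realize

theorem realize_univClosure {M : Type} [LBA.Structure M] {n : ℕ} {ψ : LBA.Formula (Fin n)} :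
    M ⊨ univClosure ψ ↔ ∀ x : Fin n → M, ψ.Realize x := by
  rw [univClosure, Sentence.Realize]
  refine BoundedFormula.realize_alls.trans (forall_congr' fun x => ?_)
  refine (BoundedFormula.realize_relabel (n := 0) (xs := x)).trans ?_
  rw [Formula.Realize]
  have h : (x ∘ Fin.natAdd n : Fin 0 → M) = default := Subsingleton.elim _ _
  rw [h]
  exact Iff.rfl

theorem realize_axiom {k : ℕ} {M : Type} [LBA.Structure M] (h : M ⊨ T k) {n : ℕ}
    {ψ : LBA.Formula (Fin n)} (hψ : Axioms k ψ) (x : Fin n → M) : ψ.Realize x :=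
  realize_univClosure.1 ((Theory.model_iff _).1 h _ ⟨n, ψ, hψ, rfl⟩) x

/-- The order and monoid axioms alone make a model of `T_k` an `Ops` with the same structure. -/
theorem exists_ops {k : ℕ} {M : Type} [s : LBA.Structure M] (h : M ⊨ T k) :
    ∃ _ : Ops M, Ops.structure M = s := by
  have add_assoc := realize_axiom h .add_assoc
  have add_comm := realize_axiom h .add_comm
  have add_zero := realize_axiom h .add_zero
  have le_refl := realize_axiom h .le_refl
  have le_trans := realize_axiom h .le_trans
  have le_antisymm := realize_axiom h .le_antisymm
  have le_total := realize_axiom h .le_total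
  have succ := realize_axiom h .succ_eq
  have hadd : ∀ (α : Type) (v : α → M) (a b : LBA.Term α), (tAdd a b).realize v =
    s.funMap Func.add ![a.realize v, b.realize v] := fun α v a b => Term.realize_functions_apply₂
  have hsucc : ∀ (α : Type) (v : α → M) (a : LBA.Term α), (tSucc a).realize v =
    s.funMap Func.succ ![a.realize v] := fun α v a => Term.realize_functions_apply₁
  have hzero : ∀ (α : Type) (v : α → M), (tZero : LBA.Term α).realize v =
    s.funMap Func.zero ![] := fun α v => by
      refine Term.realize_constants.trans ?_
      exact congrArg (s.funMap Func.zero) (Subsingleton.elim _ _)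
  have hle : ∀ (n : ℕ) (v : Fin n → M) (a b : LBA.Term (Fin n ⊕ Fin 0)),
      (Term.le a b).Realize v (default : Fin 0 → M) ↔ s.RelMap Rel.le
        ![a.realize (Sum.elim v default), b.realize (Sum.elim v default)] :=
    fun n v a b => BoundedFormula.realize_rel₂
  have hfv : ∀ (n : ℕ) (v : Fin n → M) (i : Fin n), (fv i : LBA.Term (Fin n ⊕ Fin 0)).realize
    (Sum.elim v default) = v i := fun n v i => rfl
  simp only [Formula.Realize, BoundedFormula.realize_bdEqual, hadd, hsucc, hzero, hle, hfv,
    numeral, BoundedFormula.realize_imp, BoundedFormula.realize_sup] at *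
  let _o : Ops M :=
    { add := fun a b => s.funMap Func.add ![a, b]
      zero := s.funMap Func.zero ![]
      one := s.funMap Func.succ ![s.funMap Func.zero ![] ]
      V := fun a => s.funMap Func.V ![a]
      le := fun a b => s.RelMap Rel.le ![a, b]
      add_assoc := fun a b c => add_assoc ![a, b, c]
      add_comm := fun a b => add_comm ![a, b]
      add_zero := fun a => add_zero ![a]
      zero_add := fun a => (add_comm ![_, a]).trans (add_zero ![a])
      nsmul := @nsmulRec M ⟨s.funMap Func.zero ![]⟩ ⟨fun a b => s.funMap Func.add ![a, b]⟩
      le_refl := fun a => le_refl ![a]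
      le_trans := fun a b c => le_trans ![a, b, c]
      le_antisymm := fun a b => le_antisymm ![a, b]
      le_total := fun a b => le_total ![a, b]
      toDecidableLE := Classical.decRel _ }
  refine ⟨_o, ?_⟩
  have e1 (v : Fin 1 → M) : ![v 0] = v := by ext i; fin_cases i; rfl
  have e2 (v : Fin 2 → M) : ![v 0, v 1] = v := by ext i; fin_cases i <;> rfl
  refine Structure.ext ?_ ?_
  · funext n f v
    cases f with
    | zero => exact congrArg (s.funMap Func.zero) (Subsingleton.elim _ _)
    | succ => exact (succ v).symm.trans (congrArg _ (e1 v))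
    | add => exact congrArg _ (e2 v)
    | V => exact congrArg _ (e1 v)
  · funext n r v
    cases r with
    | le => exact congrArg _ (e2 v)

theorem exists_arith {k : ℕ} (hk : 2 ≤ k) {M : Type} [s : LBA.Structure M] (h : M ⊨ T k) :
    ∃ _ : Arith k M, Ops.structure M = s := by
  obtain ⟨o, rfl⟩ := exists_ops h
  have H {n : ℕ} {ψ : LBA.Formula (Fin n)} (hψ : Axioms k ψ) (x : Fin n → M) :
    ψ.Realize x := realize_axiom h hψ x
  have add_le_add := H .add_le_add
  have add_cancel := H .add_cancel
  have discrete := H .discrete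
  have ord0 := H .ord0
  have ord1 := H .ord1
  have mod := H .mod
  have v0_zero := H .v0_zero
  have v0_one := H .v0_one
  have v1_mul := H .v1_mul
  have v1_pow := H .v1_pow
  have v2 := H .v2
  have v3 := H .v3
  have v4 := H .v4
  have v5 := H .v5
  have comp {p : ℕ} {φ : LBA.Formula (Fin (p + 1))} (hφ : IsDelta0 φ) := H (.comp φ hφ)
  clear H h
  simp only [Formula.Realize, BoundedFormula.realize_bdEqual, realize_tAdd, realize_tSucc,
    realize_tZero, realize_tV, realize_numeral, realize_nMul, Term.realize_le, Term.realize_lt,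
    realize_fv, BoundedFormula.realize_imp, BoundedFormula.realize_sup, BoundedFormula.realize_inf,
    BoundedFormula.realize_iff, BoundedFormula.realize_iSup, BoundedFormula.realize_iInf,
    realize_exLe, realize_lift, realize_new, realize_isPow, congrMod, compAxiom, realize_exLt,
    realize_allLt, realize_digitEq, BoundedFormula.realize_not, BoundedFormula.realize_relabel] at *
  let _i : IsOrderedCancelAddMonoid M :=
    { add_le_add_left := fun a b h c => add_le_add ![a, b, c] h
      le_of_add_le_add_left := fun a b c h => by
        by_contra hn
        have h1 := add_le_add ![c, b, a] (not_le.1 hn).le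
        simp only [Matrix.cons_val] at h1
        rw [add_comm c, add_comm b] at h1
        have h2 := le_antisymm h h1
        rw [add_comm a, add_comm a] at h2
        exact hn (add_cancel ![b, c, a] h2).le }
  let _c : CanonicallyOrderedAdd M :=
    { exists_add_of_le := fun {a b} h => by
        obtain ⟨c, _, hc⟩ := (ord1 ![a, b]).1 h
        exact ⟨c, hc.symm.trans (add_comm _ _)⟩
      le_add_self := fun a b => by
        have := add_le_add ![0, b, a] (ord0 ![b])
        simpa using this
      le_self_add := fun a b => by
        have := add_le_add ![0, b, a] (ord0 ![b])
        simpa [add_comm] using this }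
  let _a : Arith k M :=
    { two_le := hk
      lt_iff_succ_le := fun x y => discrete ![x, y]
      residue := fun x => by
        obtain ⟨a, z, _, h⟩ := mod ![x]
        exact ⟨a, a.2, z, h⟩
      V_zero := v0_zero default
      V_one := by simpa only [one_nsmul] using v0_one default
      V_mul := fun x => v1_mul ![x]
      V_digit := fun d hd a h1 h2 => v1_pow ![d] hd ⟨⟨a, h2⟩, h1⟩
      V_add := fun x y h1 h2 h3 => v2 ![x, y] ⟨⟨h1, h2⟩, h3⟩
      V_split := fun x hx => by
        obtain ⟨y, _, a, h⟩ := v3 ![x] hx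
        exact ⟨y, a, a.2, a.1.2, h⟩
      V_log := fun x hx => by
        obtain ⟨d, _, h⟩ := v4 ![x] hx
        exact ⟨d, h⟩
      V_V := fun x => v5 ![x]
      comp := fun p φ hφ y d hd => by
        obtain ⟨x, hx, h⟩ := comp hφ (Fin.cons d y) hd
        refine ⟨x, hx, fun e he hp => ?_⟩
        have e1 : (Sum.elim (Fin.cons d y : Fin (p + 1) → M)
            ((Fin.snoc (Fin.snoc default x) e : Fin 2 → M) ∘ Fin.castAdd 0) ∘ fun i =>
            (Fin.cases (Sum.inr 1) (fun i => Sum.inl i.succ) i : Fin (p + 1) ⊕ Fin 2)) =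
            (Fin.cons e y : Fin (p + 1) → M) := by
          funext i
          cases i using Fin.cases <;> rfl
        have := h e he hp
        have e2 : ((Fin.snoc (Fin.snoc default x) e : Fin 2 → M) ∘ Fin.natAdd 2 : Fin 0 → M) =
          default := Subsingleton.elim _ _
        rw [e1, e2] at this
        exact this }
  exact ⟨_a, rfl⟩

/-! ### Powers of `k` and their multiples -/

section Arithmetic

variable {k : ℕ} {M : Type} [Arith k M]

theorem one_pos' : (0 : M) < 1 := by
  rw [Arith.lt_iff_succ_le, zero_add]

theorem one_le_of_pos {x : M} (h : 0 < x) : 1 ≤ x := by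
  rwa [Arith.lt_iff_succ_le, zero_add] at h

theorem V_pos {x : M} (h : 0 < x) : 0 < V x := by
  obtain ⟨y, a, _, _, hx, h'⟩ := Arith.V_split x h
  rw [pos_iff_ne_zero]
  intro h0
  rw [h0, nsmul_zero, add_zero] at hx
  subst hx
  rcases h' with h' | h'
  · exact h'.ne rfl
  · exact h.ne' h'

theorem V_le (x : M) : V x ≤ x := by
  rcases eq_zero_or_pos x with rfl | h
  · rw [Arith.V_zero]
  · obtain ⟨y, a, ha, _, hx, _⟩ := Arith.V_split x h
    calc V x = 1 • V x := (one_nsmul _).symm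
      _ ≤ a • V x := nsmul_le_nsmul_left (zero_le) ha
      _ ≤ y + a • V x := le_add_self
      _ = x := hx.symm

theorem pow_V {x : M} (h : 0 < x) : Pow (V x) := ⟨V_pos h, Arith.V_V x⟩

theorem pow_one' : Pow (1 : M) := ⟨one_pos', Arith.V_one⟩

theorem Pow.one_le {d : M} (hd : Pow d) : 1 ≤ d := one_le_of_pos hd.1

theorem nsmul_lt_nsmul_of_pos {d : M} (hd : 0 < d) {a b : ℕ} (h : a < b) : a • d < b • d := by
  obtain ⟨c, rfl⟩ := Nat.exists_eq_add_of_lt h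
  have : (a + c + 1) • d = a • d + (c • d + d) := by rw [add_assoc, add_nsmul, succ_nsmul]
  rw [this]
  exact lt_add_of_pos_right _ (lt_of_lt_of_le hd le_add_self)

theorem nsmul_cancel {d : M} (hd : 0 < d) {a b : ℕ} (h : a • d = b • d) : a = b := by
  rcases lt_trichotomy a b with h' | h' | h'
  · exact absurd h (nsmul_lt_nsmul_of_pos hd h').ne
  · exact h'
  · exact absurd h (nsmul_lt_nsmul_of_pos hd h').ne'

theorem nsmul_cancel_right {x y : M} (h : k • x = k • y) : x = y := by
  have hk : k ≠ 0 := by have := Arith.two_le (M := M); omega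
  rcases lt_trichotomy x y with h' | h' | h'
  · exact absurd h (nsmul_lt_nsmul_right hk h').ne
  · exact h'
  · exact absurd h (nsmul_lt_nsmul_right hk h').ne'

theorem Pow.mul {d : M} (hd : Pow d) : Pow (k • d) := by
  have hk := Arith.two_le (M := M)
  refine ⟨?_, by rw [Arith.V_mul, hd.2]⟩
  simpa using nsmul_lt_nsmul_of_pos hd.1 (show 0 < k by omega)

theorem Pow.lt_mul {d : M} (hd : Pow d) : d < k • d := by
  have hk := Arith.two_le (M := M)
  simpa using nsmul_lt_nsmul_of_pos hd.1 (show 1 < k by omega)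

/-- A number below `n d` is `a d + r` with `a < n` and `r < d`. -/
theorem exists_eq_nsmul_add {d x : M} {n : ℕ} (h : x < n • d) :
    ∃ a < n, ∃ r < d, x = a • d + r := by
  induction n with
  | zero => simp at h
  | succ n ih =>
    rcases lt_or_ge x (n • d) with h' | h'
    · obtain ⟨a, ha, r, hr, e⟩ := ih h'
      exact ⟨a, by omega, r, hr, e⟩
    · obtain ⟨r, rfl⟩ := exists_add_of_le h'
      refine ⟨n, by omega, r, ?_, rfl⟩
      rw [succ_nsmul] at h
      exact lt_of_add_lt_add_left h

/-- There is no power of `k` strictly between `d` and `k d`. -/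
theorem Pow.mul_le {d e : M} (hd : Pow d) (he : Pow e) (h : d < e) : k • d ≤ e := by
  by_contra! hlt
  obtain ⟨a, ha, r, hr, rfl⟩ := exists_eq_nsmul_add hlt
  have ha1 : 1 ≤ a := by
    by_contra h0
    have : a = 0 := by omega
    subst this
    rw [zero_nsmul, zero_add] at h
    exact lt_asymm h hr
  have hV := Arith.V_digit d hd a ha1 ha
  rcases eq_zero_or_pos r with rfl | hr0
  · rw [add_zero] at he h
    rw [← he.2, hV] at h
    exact h.false
  · have had : 0 < a • d := by simpa using nsmul_lt_nsmul_of_pos hd.1 (show 0 < a by omega)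
    have h1 : V r < V (a • d) := by rw [hV]; exact (V_le r).trans_lt hr
    have h2 := Arith.V_add r (a • d) hr0 had h1
    rw [add_comm, he.2] at h2
    exact lt_asymm h (h2 ▸ (V_le r).trans_lt hr)

theorem Pow.lt_of_lt_mul {d e : M} (hd : Pow d) (he : Pow e) (h : e < k • d) : e ≤ d := by
  by_contra! h'
  exact absurd (hd.mul_le he h') h.not_ge

/-- A power of `k` other than `1` is `k` times a power of `k`. -/
theorem Pow.eq_one_or {d : M} (hd : Pow d) : d = 1 ∨ ∃ e, Pow e ∧ d = k • e := by
  have hk := Arith.two_le (M := M)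
  rcases hd.one_le.eq_or_lt with h1 | h1
  · exact .inl h1.symm
  right
  have key : ∀ z : M, k • z = d → Pow z := by
    rintro z rfl
    refine ⟨?_, nsmul_cancel_right (k := k) ?_⟩
    · rw [pos_iff_ne_zero]
      rintro rfl
      simpa using hd.1
    · rw [← Arith.V_mul, hd.2]
  obtain ⟨a, ha, z, h | h⟩ := Arith.residue d
  · rcases Nat.eq_zero_or_pos a with rfl | ha0
    · rw [zero_nsmul, zero_add] at h
      exact ⟨z, key z h.symm, h⟩
    · exfalso
      have hV1 := Arith.V_digit (1 : M) pow_one' a ha0 ha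
      rcases eq_zero_or_pos z with rfl | hz
      · rw [nsmul_zero, add_zero] at h
        rw [← h, hd.2] at hV1
        exact h1.ne' hV1
      · have hkz : 0 < k • z := nsmul_pos hz (by omega)
        have ha1 : 0 < a • (1 : M) := nsmul_pos one_pos' (by omega)
        have : V (a • (1 : M)) < V (k • z) := by
          rw [hV1, Arith.V_mul]
          calc (1 : M) ≤ V z := one_le_of_pos (V_pos hz)
            _ < k • V z := (pow_V hz).lt_mul
        have := Arith.V_add _ _ ha1 hkz this
        rw [← h, hd.2, hV1] at this
        exact h1.ne' this
  · exfalso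
    have hlt : d < k • (1 : M) :=
      (h ▸ le_self_add : d ≤ a • (1 : M)).trans_lt (nsmul_lt_nsmul_of_pos one_pos' ha)
    exact absurd (pow_one'.lt_of_lt_mul hd hlt) h1.not_ge

/-- `z` is a multiple of the power `d` of `k`, read off from `V`: there is no multiplication in the
language. -/
def Mult (d z : M) : Prop := z = 0 ∨ d ≤ V z

theorem Mult.zero (d : M) : Mult d 0 := .inl rfl

theorem Mult.one (z : M) : Mult 1 z := by
  rcases eq_zero_or_pos z with h | h
  · exact .inl h
  · exact .inr (one_le_of_pos (V_pos h))

theorem Mult.mono {d e z : M} (h : Mult d z) (hed : e ≤ d) : Mult e z :=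
  h.imp id hed.trans

theorem Mult.le {d z : M} (h : Mult d z) (hz : z ≠ 0) : d ≤ z :=
  (h.resolve_left hz).trans (V_le z)

theorem mult_mul_iff {d z : M} (hd : Pow d) : Mult (k • d) z ↔ z = 0 ∨ d < V z := by
  rcases eq_zero_or_pos z with rfl | hz
  · exact iff_of_true (.zero _) (.inl rfl)
  · refine or_congr_right ⟨hd.lt_mul.trans_le, hd.mul_le (pow_V hz)⟩

/-- If `w` were no multiple of `d`, then `V w < V z`, hence `V (z + w) = V w < d`. -/
theorem Mult.of_add {d z w : M} (hz : Mult d z) (h : Mult d (z + w)) : Mult d w := by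
  rcases eq_zero_or_pos w with rfl | hw
  · exact .zero d
  rcases eq_zero_or_pos z with rfl | hz0
  · rwa [zero_add] at h
  refine .inr ?_
  by_contra! hlt
  have h1 := hz.resolve_left hz0.ne'
  have h2 := Arith.V_add w z hw hz0 (hlt.trans_le h1)
  have h3 := h.resolve_left (by rw [add_eq_zero]; exact fun h => hz0.ne' h.1)
  rw [add_comm, h2] at h3
  exact hlt.not_ge h3

theorem Mult.nsmul_self {d : M} (hd : Pow d) {a : ℕ} (ha : a < k) : Mult d (a • d) := by
  rcases Nat.eq_zero_or_pos a with rfl | h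
  · rw [zero_nsmul]
    exact .zero d
  · exact .inr (Arith.V_digit d hd a h ha).ge

theorem mult_nsmul_iff {d : M} (hd : Pow d) {a : ℕ} (ha : a < k) :
    Mult (k • d) (a • d) ↔ a = 0 := by
  refine ⟨fun h => ?_, fun h => by subst h; rw [zero_nsmul]; exact .zero _⟩
  by_contra h0
  have h1 := h.le (nsmul_pos hd.1 h0).ne'
  exact (nsmul_lt_nsmul_of_pos hd.1 ha).not_ge h1

/-- Let `c = V (z + w) < d`. Then `z` and `w` are multiples of `k c`, and `z + w = y + a c` with `y`
a multiple of `k c` and `0 < a < k`. Differences of multiples are multiples by `Mult.of_add`, so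
`a c` would be a multiple of `k c`. -/
theorem Mult.add {d z w : M} (hz : Mult d z) (hw : Mult d w) : Mult d (z + w) := by
  rcases eq_zero_or_pos (z + w) with h | h
  · exact .inl h
  refine .inr ?_
  by_contra! hlt
  obtain ⟨y, a, ha, hak, e, hy⟩ := Arith.V_split _ h
  have hp := pow_V h
  set c := V (z + w)
  have hz' : Mult (k • c) z := (mult_mul_iff hp).2 (hz.imp id hlt.trans_le)
  have hw' : Mult (k • c) w := (mult_mul_iff hp).2 (hw.imp id hlt.trans_le)
  have hy' : Mult (k • c) y := (mult_mul_iff hp).2 hy.symm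
  refine (mult_nsmul_iff hp hak).not.2 (by omega) ?_
  rcases le_total y z with hyz | hyz
  · obtain ⟨u, rfl⟩ := exists_add_of_le hyz
    have hu := hy'.of_add hz'
    have e' : u + w = a • c := by
      rw [add_assoc] at e
      exact add_left_cancel e
    rw [← e']
    rcases eq_zero_or_pos w with rfl | hw0
    · rwa [add_zero]
    · exfalso
      have h1 : k • c ≤ w := hw'.le hw0.ne'
      have h2 : w ≤ a • c := e' ▸ le_add_self
      exact (nsmul_lt_nsmul_of_pos hp.1 hak).not_ge (h1.trans h2)
  · obtain ⟨u, rfl⟩ := exists_add_of_le hyz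
    have hu := hz'.of_add hy'
    rw [add_assoc] at e
    rw [add_left_cancel e] at hw'
    exact hu.of_add hw'

theorem Mult.self {d : M} (hd : Pow d) : Mult d d := .inr hd.2.ge

theorem nsmul_add_lt {d y : M} (hy : y < d) {a : ℕ} (ha : a < k) : y + a • d < k • d :=
  calc y + a • d < d + a • d := add_lt_add_left hy _
    _ = (a + 1) • d := (succ_nsmul' d a).symm
    _ ≤ k • d := nsmul_le_nsmul_left (zero_le) ha

theorem Mult.split {d z : M} (hd : Pow d) (hz : Mult d z) :
    ∃ a < k, ∃ w, Mult (k • d) w ∧ z = a • d + w := by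
  have hk := Arith.two_le (M := M)
  by_cases h : Mult (k • d) z
  · exact ⟨0, by omega, z, h, by rw [zero_nsmul, zero_add]⟩
  · rw [mult_mul_iff hd] at h
    push Not at h
    have hV := le_antisymm h.2 (hz.resolve_left h.1)
    obtain ⟨y, a, _, hak, e, hy⟩ := Arith.V_split z (pos_iff_ne_zero.2 h.1)
    rw [hV] at e hy
    exact ⟨a, hak, y, (mult_mul_iff hd).2 hy.symm, e.trans (add_comm _ _)⟩

/-- Uniqueness of division with remainder by a power of `k`. -/
theorem Mult.unique {d y z y' z' : M} (hy : y < d) (hy' : y' < d) (hz : Mult d z)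
    (hz' : Mult d z') (h : y + z = y' + z') : y = y' ∧ z = z' := by
  wlog hle : z ≤ z' generalizing y y' z z'
  · exact (this hy' hy hz' hz h.symm (le_of_not_ge hle)).imp Eq.symm Eq.symm
  obtain ⟨w, rfl⟩ := exists_add_of_le hle
  have hw := hz.of_add hz'
  have e : y = y' + w := by
    rw [add_comm z, ← add_assoc] at h
    exact add_right_cancel h
  rcases eq_zero_or_pos w with rfl | hw0
  · exact ⟨by rwa [add_zero] at e, (add_zero _).symm⟩
  · have h1 : d ≤ y := (hw.le hw0.ne').trans (e ▸ le_add_self)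
    exact absurd hy h1.not_gt

theorem digitEq_iff {x d : M} {a : ℕ} : DigitEq x d a ↔
    Pow d ∧ ∃ y < d, ∃ z, Mult (k • d) z ∧ x = y + a • d + z := by
  refine and_congr_right fun hd => exists_congr fun y => and_congr_right fun _ => ?_
  refine exists_congr fun z => ?_
  rw [mult_mul_iff hd]
  exact ⟨fun ⟨_, h1, h2⟩ => ⟨h2, h1⟩, fun ⟨h2, h1⟩ => ⟨h1 ▸ le_add_self, h1, h2⟩⟩

theorem DigitEq.unique {x d : M} {a b : ℕ} (ha : a < k) (hb : b < k) (h : DigitEq x d a)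
    (h' : DigitEq x d b) : a = b := by
  obtain ⟨hd, y, hy, z, hz, rfl⟩ := digitEq_iff.1 h
  obtain ⟨-, y', hy', z', hz', e⟩ := digitEq_iff.1 h'
  have h1 := (Mult.unique (nsmul_add_lt hy ha) (nsmul_add_lt hy' hb) hz hz' e).1
  have h2 := (Mult.unique hy hy' (.nsmul_self hd ha) (.nsmul_self hd hb) h1).2
  exact nsmul_cancel hd.1 h2

end Arithmetic

/-! ### Bounded definability and induction along the powers of `k` -/

section Subst

variable {α β : Type} {n : ℕ}

theorem lift_subst (f : α → LBA.Term β) (t : LBA.Term (α ⊕ Fin n)) :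
    (lift t).subst (Sum.elim (Term.relabel Sum.inl ∘ f) (Term.var ∘ Sum.inr)) =
      lift (t.subst (Sum.elim (Term.relabel Sum.inl ∘ f) (Term.var ∘ Sum.inr))) := by
  induction t with
  | var i =>
    rcases i with i | i
    · simp only [lift, Term.relabel, Term.subst, Sum.map_inl, Sum.elim_inl, id,
        Function.comp_apply, Term.relabel_relabel]
      rfl
    · rfl
  | func g ts ih =>
    simp only [lift, Term.relabel, Term.subst] at ih ⊢
    congr 1
    funext i
    exact ih i

theorem IsDelta0.subst (f : α → LBA.Term β) {φ : LBA.BoundedFormula α n} (h : IsDelta0 φ) :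
    IsDelta0 (φ.subst f) := by
  induction h with
  | falsum => exact .falsum
  | equal t u => exact .equal _ _
  | rel R t => exact .rel _ _
  | imp _ _ ih ih' => exact ih.imp ih'
  | @allLe n t φ _ ih =>
    have : (BuchiArith.allLe t φ).subst f = BuchiArith.allLe
        (t.subst (Sum.elim (Term.relabel Sum.inl ∘ f) (Term.var ∘ Sum.inr))) (φ.subst f) := by
      conv_rhs => rw [BuchiArith.allLe, ← lift_subst]
      simp only [BuchiArith.allLe, BoundedFormula.subst, BoundedFormula.mapTermRel, Term.le,
        Relations.boundedFormula₂, Relations.boundedFormula, id]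
      congr 3
      funext i
      fin_cases i <;> rfl
    rw [this]
    exact ih.allLe _
  | @exLe n t φ _ ih =>
    have : (BuchiArith.exLe t φ).subst f = BuchiArith.exLe
        (t.subst (Sum.elim (Term.relabel Sum.inl ∘ f) (Term.var ∘ Sum.inr))) (φ.subst f) := by
      conv_rhs => rw [BuchiArith.exLe, ← lift_subst]
      simp only [BuchiArith.exLe, BoundedFormula.subst, BoundedFormula.mapTermRel, Term.le,
        Relations.boundedFormula₂, Relations.boundedFormula, id, BoundedFormula.ex,
        BoundedFormula.not, min]
      congr 6
      funext i
      fin_cases i <;> rfl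
    rw [this]
    exact ih.exLe _

theorem realize_congr {M : Type} [LBA.Structure M] [DecidableEq α] {φ : LBA.BoundedFormula α n}
    {v v' : α → M} (h : ∀ a ∈ φ.freeVarFinset, v a = v' a) (xs : Fin n → M) :
    φ.Realize v xs ↔ φ.Realize v' xs :=
  (BoundedFormula.realize_restrictFreeVar (f := id) (v := fun a => v a) v fun _ => rfl).symm.trans
    (BoundedFormula.realize_restrictFreeVar (f := id) v' fun a => h a a.2)

end Subst

section Definable

variable {k : ℕ} {M : Type} [Arith k M] {n : ℕ}

/-- The assignment in which the variable `none` has the value `d` and `some a` stands for the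
parameter `a`. -/
def withParams (d : M) (o : Option M) : M := o.elim d id

/-- `R(d, v)` is definable in `M` by a bounded formula with parameters. -/
def D0 (R : M → (Fin n → M) → Prop) : Prop :=
  ∃ φ : LBA.BoundedFormula (Option M) n, IsDelta0 φ ∧ ∀ d v, φ.Realize (withParams d) v ↔ R d v

/-- `f(d, v)` is the value of a term with parameters. -/
def TF (f : M → (Fin n → M) → M) : Prop :=
  ∃ t : LBA.Term (Option M ⊕ Fin n), ∀ d v, t.realize (Sum.elim (withParams d) v) = f d v

theorem TF.arg : TF fun (d : M) (_ : Fin n → M) => d := ⟨fv none, fun _ _ => rfl⟩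

theorem TF.const (a : M) : TF fun (_ : M) (_ : Fin n → M) => a := ⟨fv (some a), fun _ _ => rfl⟩

theorem TF.var (i : Fin n) : TF fun (_ : M) (v : Fin n → M) => v i :=
  ⟨Term.var (Sum.inr i), fun _ _ => rfl⟩

theorem TF.add {f g : M → (Fin n → M) → M} (hf : TF f) (hg : TF g) :
    TF fun d v => f d v + g d v := by
  obtain ⟨t, ht⟩ := hf
  obtain ⟨u, hu⟩ := hg
  exact ⟨tAdd t u, fun d v => by rw [realize_tAdd, ht, hu]⟩

theorem TF.V {f : M → (Fin n → M) → M} (hf : TF f) : TF fun d v => V (f d v) := by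
  obtain ⟨t, ht⟩ := hf
  exact ⟨tV t, fun d v => by rw [realize_tV, ht]⟩

theorem TF.nsmul (a : ℕ) {f : M → (Fin n → M) → M} (hf : TF f) : TF fun d v => a • f d v := by
  obtain ⟨t, ht⟩ := hf
  exact ⟨nMul a t, fun d v => by rw [realize_nMul, ht]⟩

theorem TF.lift {f : M → (Fin n → M) → M} (hf : TF f) :
    TF fun d (v : Fin (n + 1) → M) => f d (Fin.init v) := by
  obtain ⟨t, ht⟩ := hf
  exact ⟨BuchiArith.lift t, fun d v => by
    conv_lhs => rw [← Fin.snoc_init_self v, realize_lift, ht]⟩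

theorem D0.eq {f g : M → (Fin n → M) → M} (hf : TF f) (hg : TF g) :
    D0 fun d v => f d v = g d v := by
  obtain ⟨t, ht⟩ := hf
  obtain ⟨u, hu⟩ := hg
  exact ⟨t =' u, .equal _ _, fun d v => by rw [BoundedFormula.realize_bdEqual, ht, hu]⟩

theorem D0.le {f g : M → (Fin n → M) → M} (hf : TF f) (hg : TF g) :
    D0 fun d v => f d v ≤ g d v := by
  obtain ⟨t, ht⟩ := hf
  obtain ⟨u, hu⟩ := hg
  exact ⟨Term.le t u, isDelta0_le _ _, fun d v => by rw [Term.realize_le, ht, hu]⟩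

theorem D0.prop (p : Prop) : D0 fun (_ : M) (_ : Fin n → M) => p := by
  by_cases h : p
  · exact ⟨⊤, .imp .falsum .falsum, fun d v => by simp [h]⟩
  · exact ⟨⊥, .falsum, fun d v => by simp [h]⟩

theorem D0.congr {R S : M → (Fin n → M) → Prop} (hR : D0 R) (h : ∀ d v, R d v ↔ S d v) :
    D0 S := by
  obtain ⟨φ, hφ, e⟩ := hR
  exact ⟨φ, hφ, fun d v => (e d v).trans (h d v)⟩

theorem D0.not {R : M → (Fin n → M) → Prop} (hR : D0 R) : D0 fun d v => ¬ R d v := by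
  obtain ⟨φ, hφ, e⟩ := hR
  exact ⟨∼φ, hφ.not, fun d v => by rw [BoundedFormula.realize_not, e]⟩

theorem D0.imp {R S : M → (Fin n → M) → Prop} (hR : D0 R) (hS : D0 S) :
    D0 fun d v => R d v → S d v := by
  obtain ⟨φ, hφ, e⟩ := hR
  obtain ⟨ψ, hψ, e'⟩ := hS
  exact ⟨φ ⟹ ψ, hφ.imp hψ, fun d v => by rw [BoundedFormula.realize_imp, e, e']⟩

theorem D0.and {R S : M → (Fin n → M) → Prop} (hR : D0 R) (hS : D0 S) :
    D0 fun d v => R d v ∧ S d v :=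
  ((hR.imp hS.not).not).congr fun _ _ => by tauto

theorem D0.or {R S : M → (Fin n → M) → Prop} (hR : D0 R) (hS : D0 S) :
    D0 fun d v => R d v ∨ S d v :=
  (hR.not.imp hS).congr fun _ _ => by tauto

theorem D0.iff {R S : M → (Fin n → M) → Prop} (hR : D0 R) (hS : D0 S) :
    D0 fun d v => (R d v ↔ S d v) :=
  ((hR.imp hS).and (hS.imp hR)).congr fun _ _ => by tauto

theorem D0.forall {β : Type} [Finite β] {R : β → M → (Fin n → M) → Prop} (hR : ∀ b, D0 (R b)) :
    D0 fun d v => ∀ b, R b d v := by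
  choose φ hφ e using hR
  exact ⟨_, IsDelta0.iInf hφ, fun d v => by simp only [BoundedFormula.realize_iInf, e]⟩

theorem D0.exists {β : Type} [Finite β] {R : β → M → (Fin n → M) → Prop} (hR : ∀ b, D0 (R b)) :
    D0 fun d v => ∃ b, R b d v := by
  choose φ hφ e using hR
  exact ⟨_, IsDelta0.iSup hφ, fun d v => by simp only [BoundedFormula.realize_iSup, e]⟩

theorem D0.exLe {f : M → (Fin n → M) → M} {R : M → (Fin n → M) → M → Prop} (hf : TF f)
    (hR : D0 fun d (w : Fin (n + 1) → M) => R d (Fin.init w) (w (Fin.last n))) :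
    D0 fun d v => ∃ b ≤ f d v, R d v b := by
  obtain ⟨t, ht⟩ := hf
  obtain ⟨φ, hφ, e⟩ := hR
  exact ⟨_, hφ.exLe t, fun d v => by
    simp only [realize_exLe, ht, e, Fin.init_snoc, Fin.snoc_last]⟩

theorem D0.exLt {f : M → (Fin n → M) → M} {R : M → (Fin n → M) → M → Prop} (hf : TF f)
    (hR : D0 fun d (w : Fin (n + 1) → M) => R d (Fin.init w) (w (Fin.last n))) :
    D0 fun d v => ∃ b < f d v, R d v b := by
  obtain ⟨t, ht⟩ := hf
  obtain ⟨φ, hφ, e⟩ := hR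
  exact ⟨_, hφ.exLt t, fun d v => by
    simp only [realize_exLt, ht, e, Fin.init_snoc, Fin.snoc_last]⟩

theorem D0.mult {f g : M → (Fin n → M) → M} (hf : TF f) (hg : TF g) :
    D0 fun d v => Mult (f d v) (g d v) :=
  (D0.eq hg (.const 0)).or (D0.le hf hg.V)

/-- Comprehension for properties definable by a bounded formula with arbitrary parameters: only
finitely many parameters occur in the formula, and they can be made its free variables. -/
theorem D0.comprehension {R : M → Prop} (hR : D0 fun d (_ : Fin 0 → M) => R d) {d : M}
    (hd : Pow d) : ∃ x < d, ∀ e < d, Pow e → (DigitEq x e 1 ∧ R e) ∨ (DigitEq x e 0 ∧ ¬ R e) := by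
  classical
  obtain ⟨φ, hφ, hR⟩ := hR
  let s := φ.freeVarFinset
  let y : Fin s.card → M := fun i => ((s.equivFin.symm i : Option M)).elim 0 id
  let f : Option M → LBA.Term (Fin (s.card + 1)) := fun o =>
    if h : o ≠ none ∧ o ∈ s then Term.var (s.equivFin ⟨o, h.2⟩).succ else Term.var 0
  obtain ⟨x, hx, h⟩ := Arith.comp s.card (φ.subst f) (hφ.subst f) y d hd
  refine ⟨x, hx, fun e he hp => ?_⟩
  have key : Formula.Realize (φ.subst f) (Fin.cons e y : Fin (s.card + 1) → M) ↔ R e := by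
    rw [Formula.Realize, BoundedFormula.realize_subst]
    refine Iff.trans ?_ (hR e default)
    refine realize_congr (fun o ho => ?_) _
    rcases o with _ | a
    · simp [f, withParams]
    · have : f (some a) = Term.var (s.equivFin ⟨some a, ho⟩).succ := by
        simp only [f]
        rw [dif_pos ⟨by simp, ho⟩]
      rw [this]
      simp [y, withParams]
  have := h e he hp
  rwa [key] at this

theorem not_digitEq_zero_one (d : M) : ¬ DigitEq (0 : M) d 1 := by
  rintro ⟨hd, y, _, z, _, h, _⟩
  have h1 : d ≤ y + 1 • d + z := by
    rw [one_nsmul]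
    exact le_add_self.trans le_self_add
  rw [← h] at h1
  exact hd.1.not_ge h1

/-- The least number principle for the powers of `k`: if `x` has the digit `1` at the powers at
which `R` holds and `0` at the others, then `V x` is the least power at which `R` holds. -/
theorem D0.exists_least {R : M → Prop} (hR : D0 fun d (_ : Fin 0 → M) => R d) {d : M}
    (hd : Pow d) (h : R d) : ∃ e, Pow e ∧ R e ∧ ∀ e' < e, Pow e' → ¬ R e' := by
  have hk := Arith.two_le (M := M)
  obtain ⟨x, hx, hxR⟩ := hR.comprehension hd.mul
  have hx0 : x ≠ 0 := by
    rintro rfl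
    rcases hxR d hd.lt_mul hd with h' | h'
    · exact not_digitEq_zero_one d h'.1
    · exact h'.2 h
  have hpos := pos_iff_ne_zero.2 hx0
  have hp := pow_V hpos
  have hlt : V x < k • d := (V_le x).trans_lt hx
  obtain ⟨y, a, ha, hak, e, hy⟩ := Arith.V_split x hpos
  have hdig : DigitEq x (V x) a := digitEq_iff.2 ⟨hp, 0, hp.1, y, (mult_mul_iff hp).2 hy.symm, by
    rw [zero_add, add_comm]
    exact e⟩
  refine ⟨V x, hp, ?_, fun e' he' hp' hR' => ?_⟩
  · rcases hxR _ hlt hp with h' | h'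
    · exact h'.2
    · have := hdig.unique hak (by omega) h'.1
      omega
  · have h0 : DigitEq x e' 0 := digitEq_iff.2 ⟨hp', 0, hp'.1, x, .inr (hp'.mul_le hp he'), by
      rw [zero_nsmul, zero_add, zero_add]⟩
    rcases hxR _ (he'.trans hlt) hp' with h' | h'
    · have := h0.unique (by omega) (by omega) h'.1
      omega
    · exact h'.2 hR'

/-- Induction along the powers of `k` from `a` to `b`. -/
theorem pow_induction_Icc {R : M → Prop} (hR : D0 fun d (_ : Fin 0 → M) => R d) {a b : M}
    (ha : Pow a) (h0 : R a) (hs : ∀ d, Pow d → a ≤ d → d < b → R d → R (k • d)) {d : M}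
    (hd : Pow d) (had : a ≤ d) (hdb : d ≤ b) : R d := by
  by_contra hn
  have hR' : D0 fun d (_ : Fin 0 → M) => a ≤ d ∧ d ≤ b ∧ ¬ R d :=
    (D0.le (.const a) .arg).and ((D0.le .arg (.const b)).and hR.not)
  obtain ⟨e, he, ⟨h1, h2, h3⟩, hmin⟩ := hR'.exists_least hd ⟨had, hdb, hn⟩
  rcases h1.eq_or_lt with rfl | h1
  · exact h3 h0
  rcases he.eq_one_or with rfl | ⟨c, hc, rfl⟩
  · exact absurd ha.one_le h1.not_ge
  · have hac : a ≤ c := hc.lt_of_lt_mul ha h1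
    refine hmin c hc.lt_mul hc ⟨hac, hc.lt_mul.le.trans h2, fun hRc => h3 ?_⟩
    exact hs c hc hac (hc.lt_mul.trans_le h2) hRc

theorem pow_induction {R : M → Prop} (hR : D0 fun d (_ : Fin 0 → M) => R d)
    (h0 : R 1) (hs : ∀ d, Pow d → R d → R (k • d)) {d : M} (hd : Pow d) : R d :=
  pow_induction_Icc hR pow_one' h0 (fun d hd _ _ => hs d hd) hd hd.one_le le_rfl

end Definable

/-! ### Digits -/

section Digits

variable {k : ℕ} {M : Type} [Arith k M] {n : ℕ}

/-- Division with remainder, by induction along the powers of `k`. -/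
theorem exists_div {d : M} (hd : Pow d) (x : M) : ∃ y < d, ∃ z ≤ x, Mult d z ∧ x = y + z := by
  refine pow_induction (R := fun d => ∃ y < d, ∃ z ≤ x, Mult d z ∧ x = y + z) ?_ ?_ ?_ hd
  · exact .exLt .arg (.exLe (.const x) (.and (.mult .arg (.var _))
      (.eq (.const x) (.add (TF.var (Fin.last 0)).lift (.var _)))))
  · exact ⟨0, one_pos', x, le_rfl, .one x, (zero_add x).symm⟩
  · rintro d hd ⟨y, hy, z, _, hz, rfl⟩
    obtain ⟨a, ha, w, hw, rfl⟩ := hz.split hd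
    exact ⟨y + a • d, nsmul_add_lt hy ha, w, le_add_self.trans le_add_self, hw,
      (add_assoc _ _ _).symm⟩

open Classical in
/-- The remainder of `x` modulo the power `d` of `k`; it is `0` if `d` is no power of `k`. -/
noncomputable def low (x d : M) : M := if h : Pow d then (exists_div h x).choose else 0

theorem low_lt {d : M} (hd : Pow d) (x : M) : low x d < d := by
  rw [low, dif_pos hd]
  exact (exists_div hd x).choose_spec.1

theorem low_spec {d : M} (hd : Pow d) (x : M) : ∃ z, Mult d z ∧ x = low x d + z := by
  rw [low, dif_pos hd]
  obtain ⟨-, z, -, h⟩ := (exists_div hd x).choose_spec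
  exact ⟨z, h⟩

theorem low_eq {d y z : M} (hd : Pow d) (hy : y < d) (hz : Mult d z) : low (y + z) d = y := by
  obtain ⟨w, hw, e⟩ := low_spec hd (y + z)
  exact (Mult.unique (low_lt hd _) hy hw hz e.symm).1

theorem low_of_lt {d x : M} (hd : Pow d) (hx : x < d) : low x d = x := by
  simpa using low_eq hd hx (.zero d)

theorem low_one (x : M) : low x 1 = 0 := by
  simpa using low_eq pow_one' one_pos' (.one x)

theorem low_le {d : M} (hd : Pow d) (x : M) : low x d ≤ x := by
  obtain ⟨z, _, h⟩ := low_spec hd x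
  conv_rhs => rw [h]
  exact le_self_add

theorem exists_digit {d : M} (hd : Pow d) (x : M) : ∃ a : Fin k, DigitEq x d a := by
  obtain ⟨z, hz, h⟩ := low_spec hd x
  obtain ⟨a, ha, w, hw, rfl⟩ := hz.split hd
  exact ⟨⟨a, ha⟩, digitEq_iff.2 ⟨hd, _, low_lt hd x, w, hw, by rwa [add_assoc]⟩⟩

open Classical in
/-- The digit of `x` at the power `d` of `k`; it is `0` if `d` is no power of `k`. -/
noncomputable def dig (x d : M) : Fin k :=
  if h : Pow d then (exists_digit h x).choose else ⟨0, by have := Arith.two_le (M := M); omega⟩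

theorem digitEq_dig {d : M} (hd : Pow d) (x : M) : DigitEq x d (dig x d) := by
  rw [dig, dif_pos hd]
  exact (exists_digit hd x).choose_spec

theorem dig_eq_iff {d : M} (hd : Pow d) {x : M} {a : Fin k} : dig x d = a ↔ DigitEq x d a := by
  refine ⟨fun h => h ▸ digitEq_dig hd x, fun h => ?_⟩
  exact Fin.ext ((digitEq_dig hd x).unique (dig x d).2 a.2 h)

theorem dig_eq {d y z : M} (hd : Pow d) (hy : y < d) (a : Fin k) (hz : Mult (k • d) z) :
    dig (y + (a : ℕ) • d + z) d = a :=
  (dig_eq_iff hd).2 (digitEq_iff.2 ⟨hd, y, hy, z, hz, rfl⟩)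

theorem low_mul {d : M} (hd : Pow d) (x : M) : low x (k • d) = low x d + (dig x d : ℕ) • d := by
  obtain ⟨-, y, hy, z, hz, h⟩ := digitEq_iff.1 (digitEq_dig hd x)
  have h1 : low x (k • d) = y + (dig x d : ℕ) • d := by
    conv_lhs => rw [h]
    exact low_eq hd.mul (nsmul_add_lt hy (dig x d).2) hz
  have h2 : low x d = y := by
    conv_lhs => rw [h, add_assoc]
    exact low_eq hd hy ((Mult.nsmul_self hd (dig x d).2).add (hz.mono hd.lt_mul.le))
  rw [h1, h2]

theorem DigitEq.add_mult {x d z : M} {a : ℕ} (h : DigitEq x d a) (hz : Mult (k • d) z) :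
    DigitEq (x + z) d a := by
  obtain ⟨hd, y, hy, w, hw, rfl⟩ := digitEq_iff.1 h
  exact digitEq_iff.2 ⟨hd, y, hy, w + z, hw.add hz, add_assoc _ _ _⟩

theorem dig_add_mult {d z : M} (hd : Pow d) (hz : Mult (k • d) z) (x : M) :
    dig (x + z) d = dig x d :=
  (dig_eq_iff hd).2 ((digitEq_dig hd x).add_mult hz)

theorem dig_low {d e : M} (hd : Pow d) (he : Pow e) (h : e < d) (x : M) :
    dig (low x d) e = dig x e := by
  obtain ⟨z, hz, hx⟩ := low_spec hd x
  conv_rhs => rw [hx]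
  exact (dig_add_mult he (hz.mono (he.mul_le hd h)) _).symm

theorem dig_of_lt {d x : M} (hd : Pow d) (hx : x < d) : (dig x d : ℕ) = 0 := by
  have hk := Arith.two_le (M := M)
  have := dig_eq hd hx ⟨0, by omega⟩ (.zero _)
  rw [zero_nsmul, add_zero, add_zero] at this
  rw [this]

theorem D0.isPow {f : M → (Fin n → M) → M} (hf : TF f) : D0 fun d v => Pow (f d v) :=
  (((D0.le hf (.const 0)).not).and (D0.eq hf.V hf)).congr fun _ _ => by rw [not_le]; exact Iff.rfl

theorem D0.low {f g h : M → (Fin n → M) → M} (hf : TF f) (hg : TF g) (hh : TF h) :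
    D0 fun d v => low (f d v) (g d v) = h d v := by
  have key : D0 fun d v => (Pow (g d v) ∧ ¬ g d v ≤ h d v ∧
      ∃ z ≤ f d v, Mult (g d v) z ∧ f d v = h d v + z) ∨ (¬ Pow (g d v) ∧ 0 = h d v) :=
    ((D0.isPow hg).and ((D0.le hg hh).not.and (D0.exLe hf ((D0.mult hg.lift (.var _)).and
      (D0.eq hf.lift (hh.lift.add (.var _))))))).or ((D0.isPow hg).not.and (.eq (.const 0) hh))
  refine key.congr fun d v => ?_
  by_cases hp : Pow (g d v)
  · simp only [hp, true_and, not_true, false_and, or_false, not_le]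
    constructor
    · rintro ⟨h1, z, _, h2, h3⟩
      rw [h3]
      exact low_eq hp h1 h2
    · intro e
      obtain ⟨z, hz, hx⟩ := low_spec hp (f d v)
      exact ⟨e ▸ low_lt hp _, z, hx ▸ le_add_self, hz, by rwa [← e]⟩
  · simp only [hp, false_and, not_false_eq_true, true_and, false_or]
    rw [BuchiArith.low, dif_neg hp]

theorem exists_pow_gt (x : M) : ∃ d, Pow d ∧ x < d := by
  rcases eq_zero_or_pos x with rfl | h
  · exact ⟨1, pow_one', one_pos'⟩
  · obtain ⟨d, hd, _, h'⟩ := Arith.V_log x h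
    exact ⟨_, hd.mul, h'⟩

end Digits

/-! ### Runs of automata in models of `T_k` -/

section Runs

variable {k : ℕ} {M : Type} [Arith k M] {n : ℕ} {ι Q : Type}

/-- The meaning of the formula `W_{A,q}(x, d)`. -/
def Run (A : DFA (ι → Fin k) Q) (x : ι → M) (d : M) (q₁ : Q) : Prop :=
  Pow d ∧ ∃ w : Q → M, (∀ q, w q < k • d) ∧
    ((∀ e ≤ d, Pow e → ∃ q, DigitEq (w q) e 1 ∧ ∀ q' : {q' : Q // q' ≠ q}, DigitEq (w q') e 0) ∧
      (DigitEq (w A.start) 1 1 ∧ DigitEq (w q₁) d 1)) ∧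
    ∀ e < d, Pow e → ∀ q, DigitEq (w q) e 1 → ∃ a : ι → Fin k,
      DigitEq (w (A.step q a)) (k • e) 1 ∧ ∀ i, DigitEq (x i) e (a i)

theorem realize_W [Finite Q] {α : Type} {m : ℕ} {A : DFA (Fin m → Fin k) Q} {q : Q}
    {x : Fin m → LBA.Term (α ⊕ Fin n)} {d : LBA.Term (α ⊕ Fin n)} {v : α → M} {xs : Fin n → M} :
    (W A q x d).Realize v xs ↔ Run A (fun i => (x i).realize (Sum.elim v xs))
      (d.realize (Sum.elim v xs)) q := by
  simp only [W, Run, BoundedFormula.realize_inf, realize_isPow, realize_exsLt, realize_nMul,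
    realize_allLe, realize_liftN, BoundedFormula.realize_imp, BoundedFormula.realize_iSup,
    BoundedFormula.realize_iInf, realize_digitEq, realize_lift, realize_new, realize_allLt,
    Term.realize_var, Sum.elim_inr, Fin.append_right, realize_numeral, one_nsmul]
  refine and_congr_right fun _ => ?_
  constructor
  · rintro ⟨w, hw, h⟩
    exact ⟨fun q => w (Finite.equivFin Q q), fun q => hw _, h⟩
  · rintro ⟨w, hw, h⟩
    refine ⟨fun i => w ((Finite.equivFin Q).symm i), fun i => hw _, ?_⟩
    simpa only [Equiv.symm_apply_apply] using h

/-- The letter that an automaton reads at the power `d` of `k`. -/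
noncomputable def digits (x : ι → M) (d : M) : ι → Fin k := fun i => dig (x i) d

theorem run_step_iff (A : DFA (ι → Fin k) Q) (x : ι → M) (w : Q → M) {e : M} (he : Pow e) (q : Q) :
    (∃ a : ι → Fin k, DigitEq (w (A.step q a)) (k • e) 1 ∧ ∀ i, DigitEq (x i) e (a i)) ↔
      DigitEq (w (A.step q (digits x e))) (k • e) 1 := by
  constructor
  · rintro ⟨a, h, ha⟩
    have : digits x e = a := funext fun i => (dig_eq_iff he).2 (ha i)
    rwa [this]
  · exact fun h => ⟨_, h, fun i => digitEq_dig he _⟩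

/-- A coding `w` of states has at most one state at `e`. -/
theorem Run.eq_of {w : Q → M} {e : M}
    (h : ∃ q, DigitEq (w q) e 1 ∧ ∀ q' : {q' : Q // q' ≠ q}, DigitEq (w q') e 0) {q q' : Q}
    (hq : DigitEq (w q) e 1) (hq' : DigitEq (w q') e 1) : q = q' := by
  have hk := Arith.two_le (M := M)
  obtain ⟨p, -, hp⟩ := h
  have key : ∀ r, DigitEq (w r) e 1 → r = p := by
    intro r hr
    by_contra hne
    have := hr.unique (by omega) (by omega) (hp ⟨r, hne⟩)
    omega
  rw [key q hq, key q' hq']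

theorem pow_le_one {e : M} (he : Pow e) (h : e ≤ 1) : e = 1 := le_antisymm h he.one_le

theorem digitEq_self {d : M} (hd : Pow d) : DigitEq d d 1 :=
  digitEq_iff.2 ⟨hd, 0, hd.1, 0, .zero _, by simp⟩

theorem digitEq_zero {d : M} (hd : Pow d) : DigitEq (0 : M) d 0 :=
  digitEq_iff.2 ⟨hd, 0, hd.1, 0, .zero _, by simp⟩

theorem DigitEq.low_iff {x d e : M} {a : ℕ} (hd : Pow d) (ha : a < k) (h : e < d) :
    DigitEq (low x d) e a ↔ DigitEq x e a := by
  by_cases he : Pow e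
  · rw [← dig_eq_iff he (a := ⟨a, ha⟩), ← dig_eq_iff he (a := ⟨a, ha⟩), dig_low hd he h]
  · exact iff_of_false (fun h => he h.1) (fun h => he h.1)

theorem run_one (A : DFA (ι → Fin k) Q) (x : ι → M) (q : Q) : Run A x 1 q ↔ q = A.start := by
  classical
  constructor
  · rintro ⟨-, w, -, ⟨h1, h2, h3⟩, -⟩
    exact Run.eq_of (h1 1 le_rfl pow_one') h3 h2
  · rintro rfl
    let w : Q → M := fun p => if p = A.start then 1 else 0
    have hw1 : w A.start = 1 := if_pos rfl
    have hw0 : ∀ p, p ≠ A.start → w p = 0 := fun p hp => if_neg hp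
    refine ⟨pow_one', w, fun p => ?_, ⟨fun e he hp => ?_, ?_⟩,
      fun e he hp => absurd hp.one_le he.not_ge⟩
    · by_cases hp : p = A.start
      · rw [hp, hw1]
        exact pow_one'.lt_mul
      · rw [hw0 p hp]
        exact pow_one'.mul.1
    · obtain rfl := pow_le_one hp he
      refine ⟨A.start, ?_, fun q' => ?_⟩
      · rw [hw1]
        exact digitEq_self hp
      · rw [hw0 q' q'.2]
        exact digitEq_zero hp
    · rw [hw1]
      exact ⟨digitEq_self pow_one', digitEq_self pow_one'⟩

/-- A run up to `k d` is a run up to `d` followed by one transition: the witnesses `w` are cut down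
modulo `k d` in one direction and receive one more digit, at `k d`, in the other. -/
theorem run_mul (A : DFA (ι → Fin k) Q) (x : ι → M) {d : M} (hd : Pow d) (q' : Q) :
    Run A x (k • d) q' ↔ ∃ q, Run A x d q ∧ A.step q (digits x d) = q' := by
  classical
  have hk := Arith.two_le (M := M)
  constructor
  · rintro ⟨-, w, -, ⟨h1, h2, h3⟩, h4⟩
    have L0 {y e : M} (he : e < k • d) := DigitEq.low_iff (x := y) (a := 0) hd.mul (by omega) he
    have L1 {y e : M} (he : e < k • d) := DigitEq.low_iff (x := y) (a := 1) hd.mul (by omega) he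
    obtain ⟨q, hq, -⟩ := h1 d hd.lt_mul.le hd
    have hs := (run_step_iff A x w hd q).1 (h4 d hd.lt_mul hd q hq)
    refine ⟨q, ⟨hd, fun p => low (w p) (k • d), fun p => low_lt hd.mul _,
      ⟨fun e he hp => ?_, ?_⟩, fun e he hp p => ?_⟩, Run.eq_of (h1 _ le_rfl hd.mul) hs h3⟩
    · simp only [L0 (he.trans_lt hd.lt_mul), L1 (he.trans_lt hd.lt_mul)]
      exact h1 e (he.trans hd.lt_mul.le) hp
    · rw [L1 hd.lt_mul, L1 (hd.one_le.trans_lt hd.lt_mul)]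
      exact ⟨h2, hq⟩
    · rw [L1 (he.trans hd.lt_mul)]
      simp only [L1 ((hp.mul_le hd he).trans_lt hd.lt_mul)]
      exact h4 e (he.trans hd.lt_mul) hp p
  · rintro ⟨q, ⟨-, w, hw, ⟨h1, h2, h3⟩, h4⟩, rfl⟩
    set q' := A.step q (digits x d) with hq'
    let w' : Q → M := fun p => w p + (if p = q' then 1 else 0) • (k • d)
    have hold : ∀ (p : Q) (e : M) (a : ℕ), e ≤ d → DigitEq (w p) e a → DigitEq (w' p) e a := by
      intro p e a he h
      refine h.add_mult ?_
      split_ifs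
      · rw [one_nsmul]
        exact (Mult.self hd.mul).mono (nsmul_le_nsmul_right he k)
      · rw [zero_nsmul]
        exact .zero _
    have hnew1 : DigitEq (w' q') (k • d) 1 := digitEq_iff.2 ⟨hd.mul, w q', hw _, 0, .zero _, by
      simp [w']⟩
    have hnew0 : ∀ p, p ≠ q' → DigitEq (w' p) (k • d) 0 := fun p hp =>
      digitEq_iff.2 ⟨hd.mul, w p, hw _, 0, .zero _, by simp [w', hp]⟩
    have hex : ∀ e ≤ d, Pow e → ∃ p, DigitEq (w' p) e 1 ∧
        ∀ p' : {p' : Q // p' ≠ p}, DigitEq (w' p') e 0 := by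
      intro e he hp
      obtain ⟨p, h, h'⟩ := h1 e he hp
      exact ⟨p, hold _ _ _ he h, fun p' => hold _ _ _ he (h' p')⟩
    refine ⟨hd.mul, w', fun p => ?_, ⟨fun e he hp => ?_, ?_⟩, fun e he hp p hpe => ?_⟩
    · simp only [w']
      split_ifs
      · exact nsmul_add_lt (hw p) (by omega)
      · rw [zero_nsmul, add_zero]
        exact (hw p).trans hd.mul.lt_mul
    · rcases he.eq_or_lt with rfl | he
      · exact ⟨q', hnew1, fun p => hnew0 p p.2⟩
      · exact hex e (hd.lt_of_lt_mul hp he) hp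
    · exact ⟨hold _ _ _ hd.one_le h2, hnew1⟩
    · rw [run_step_iff A x w' hp]
      rcases (hd.lt_of_lt_mul hp he).eq_or_lt with rfl | hed
      · obtain rfl := Run.eq_of (hex _ le_rfl hd) (hold _ _ _ le_rfl h3) hpe
        exact hnew1
      · obtain ⟨r, hr, -⟩ := h1 e hed.le hp
        obtain rfl := Run.eq_of (hex e hed.le hp) (hold _ _ _ hed.le hr) hpe
        exact hold _ _ _ (hp.mul_le hd hed) ((run_step_iff A x w hp r).1 (h4 e hed hp r hr))

theorem D0.run [Finite ι] [Finite Q] (A : DFA (ι → Fin k) Q) {f : ι → M → (Fin n → M) → M}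
    {g : M → (Fin n → M) → M} (hf : ∀ i, TF (f i)) (hg : TF g) (q : Q) :
    D0 fun d v => Run A (fun i => f i d v) (g d v) q := by
  choose t ht using hf
  obtain ⟨u, hu⟩ := hg
  let e := Finite.equivFin ι
  let B : DFA (Fin (Nat.card ι) → Fin k) Q := ⟨fun q a => A.step q (a ∘ e), A.start, A.accept⟩
  refine ⟨_, isDelta0_W B q (t ∘ e.symm) u, fun d v => ?_⟩
  simp only [realize_W, Function.comp_apply, ht, hu]
  refine and_congr_right fun _ => exists_congr fun w => and_congr_right fun _ =>
    and_congr_right fun _ => forall_congr' fun c => forall_congr' fun _ => forall_congr' fun hc =>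
    forall_congr' fun p => forall_congr' fun _ => ?_
  rw [run_step_iff A _ _ hc, run_step_iff B _ _ hc]
  simp only [B, digits, Function.comp_def, Equiv.symm_apply_apply]
  exact Iff.rfl

theorem exists_run [Finite ι] [Finite Q] (A : DFA (ι → Fin k) Q) (x : ι → M) {d : M} (hd : Pow d) :
    ∃ q, Run A x d q ∧ ∀ q', Run A x d q' → q' = q := by
  refine pow_induction (R := fun d => ∃ q, Run A x d q ∧ ∀ q', Run A x d q' → q' = q) ?_ ?_ ?_ hd
  · have h : ∀ q, D0 fun d (_ : Fin 0 → M) => Run A x d q := fun q =>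
      D0.run A (f := fun i _ _ => x i) (fun i => .const (x i)) .arg q
    exact .exists fun q => (h q).and (.forall fun q' => (h q').imp (.prop _))
  · simp only [run_one]
    exact ⟨A.start, rfl, fun _ h => h⟩
  · rintro d hd ⟨q, hq, hu⟩
    simp only [run_mul A x hd]
    refine ⟨_, ⟨q, hq, rfl⟩, ?_⟩
    rintro _ ⟨p, hp, rfl⟩
    rw [hu p hp]

open Classical in
/-- The state that `A` reaches after reading the digits of `x` at the powers of `k` below the
power `d`. -/
noncomputable def st [Finite ι] [Finite Q] (A : DFA (ι → Fin k) Q) (x : ι → M) (d : M) : Q :=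
  if h : Pow d then (exists_run A x h).choose else A.start

variable [Finite ι] [Finite Q] (A : DFA (ι → Fin k) Q)

theorem st_eq_iff (x : ι → M) {d : M} (hd : Pow d) (q : Q) : st A x d = q ↔ Run A x d q := by
  rw [st, dif_pos hd]
  have := (exists_run A x hd).choose_spec
  exact ⟨fun h => h ▸ this.1, fun h => (this.2 q h).symm⟩

theorem st_one (x : ι → M) : st A x 1 = A.start := by
  rw [st_eq_iff A x pow_one', run_one]

theorem st_mul (x : ι → M) {d : M} (hd : Pow d) :
    st A x (k • d) = A.step (st A x d) (digits x d) := by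
  rw [st_eq_iff A x hd.mul, run_mul A x hd]
  exact ⟨_, (st_eq_iff A x hd _).1 rfl, rfl⟩

theorem D0.st {f : ι → M → (Fin n → M) → M} {g : M → (Fin n → M) → M} (hf : ∀ i, TF (f i))
    (hg : TF g) (q : Q) : D0 fun d v => st A (fun i => f i d v) (g d v) = q := by
  have key := (D0.run A hf hg q).or ((D0.isPow hg).not.and (.prop (A.start = q)))
  refine key.congr fun d v => ?_
  by_cases hp : Pow (g d v)
  · rw [st_eq_iff A _ hp]
    simp [hp]
  · have : ¬ Run A (fun i => f i d v) (g d v) q := fun h => hp h.1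
    rw [BuchiArith.st, dif_neg hp]
    simp [this, hp]

/-- A bounded definable invariant of the run of `A` on `x`, from the power `a` of `k` to `b`. -/
theorem st_induction (x : ι → M) {I : M → Q → Prop} (hI : ∀ q, D0 fun d (_ : Fin 0 → M) => I d q)
    {a b : M} (ha : Pow a) (h0 : I a (st A x a))
    (hs : ∀ d, Pow d → a ≤ d → d < b → I d (st A x d) →
      I (k • d) (A.step (st A x d) (digits x d)))
    {d : M} (hd : Pow d) (had : a ≤ d) (hdb : d ≤ b) : I d (st A x d) := by
  have hst : ∀ q, D0 fun d (_ : Fin 0 → M) => BuchiArith.st A x d = q := fun q =>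
    D0.st A (f := fun i _ _ => x i) (fun i => .const (x i)) .arg q
  have : ∃ q, st A x d = q ∧ I d q := by
    refine pow_induction_Icc (R := fun d => ∃ q, st A x d = q ∧ I d q)
      (.exists fun q => (hst q).and (hI q)) ha ⟨_, rfl, h0⟩ ?_ hd had hdb
    rintro d hd h1 h2 ⟨_, rfl, h⟩
    exact ⟨_, rfl, st_mul A x hd ▸ hs d hd h1 h2 h⟩
  obtain ⟨_, rfl, h⟩ := this
  exact h

end Runs

/-! ### Recognizable relations -/

/-- The assignment that extends `x` by the value `y` of a new variable. -/
def cons {ι M : Type} (y : M) (x : ι → M) (o : Option ι) : M := o.elim y x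

theorem digits_cons {k : ℕ} {M : Type} [Arith k M] {ι : Type} (y : M) (x : ι → M) (d : M) :
    digits (cons y x) d = cons (dig y d) (digits x d) := by
  funext o
  cases o <;> rfl

section Recognizable

variable {k : ℕ} {ι κ : Type} [Finite ι] [Finite κ]

/-- A single automaton recognizes `R` in every model of `T_k`: whenever `d` is a power of `k` above
all the entries of `x`, the state reached at `d` decides `R(x)`. The choice of `d` is free, so that
the automaton is insensitive to leading zeros. -/
def Recog (k : ℕ) {ι : Type} [Finite ι] (R : ∀ (M : Type) [Arith k M], (ι → M) → Prop) : Prop :=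
  ∃ (Q : Type) (_ : Finite Q) (A : DFA (ι → Fin k) Q), ∀ (M : Type) [Arith k M] (x : ι → M) (d : M),
    Pow d → (∀ i, x i < d) → (R M x ↔ st A x d ∈ A.accept)

variable {R S : ∀ (M : Type) [Arith k M], (ι → M) → Prop}

theorem Recog.congr (hR : Recog k R) (h : ∀ (M : Type) [Arith k M] (x : ι → M), R M x ↔ S M x) :
    Recog k S := by
  obtain ⟨Q, hQ, A, hA⟩ := hR
  exact ⟨Q, hQ, A, fun M _ x d hd hx => (h M x).symm.trans (hA M x d hd hx)⟩

theorem Recog.bot : Recog k fun (M : Type) [Arith k M] (_ : ι → M) => False :=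
  ⟨Unit, inferInstance, ⟨fun _ _ => (), (), ∅⟩, fun _ _ _ _ _ _ => Iff.rfl⟩

theorem Recog.imp (hR : Recog k R) (hS : Recog k S) :
    Recog k fun (M : Type) [Arith k M] (x : ι → M) => R M x → S M x := by
  obtain ⟨Q, _, A, hA⟩ := hR
  obtain ⟨P, _, B, hB⟩ := hS
  let C : DFA (ι → Fin k) (Q × P) := ⟨fun q a => (A.step q.1 a, B.step q.2 a), (A.start, B.start),
    {q | q.1 ∈ A.accept → q.2 ∈ B.accept}⟩
  refine ⟨Q × P, inferInstance, C, fun M _ x d hd hx => ?_⟩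
  have : st A x d = (st C x d).1 ∧ st B x d = (st C x d).2 := by
    refine st_induction C x (I := fun d q => st A x d = q.1 ∧ st B x d = q.2) (fun q => ?_)
      pow_one' ?_ ?_ hd hd.one_le le_rfl
    · exact (D0.st A (f := fun i _ _ => x i) (fun i => .const (x i)) .arg _).and
        (D0.st B (f := fun i _ _ => x i) (fun i => .const (x i)) .arg _)
    · simp only [st_one, C, and_self]
    · rintro d hd _ _ ⟨h1, h2⟩
      rw [st_mul A x hd, st_mul B x hd, h1, h2]
      exact ⟨rfl, rfl⟩
  beta_reduce
  rw [hA M x d hd hx, hB M x d hd hx, this.1, this.2]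
  exact Iff.rfl

theorem Recog.not (hR : Recog k R) :
    Recog k fun (M : Type) [Arith k M] (x : ι → M) => ¬ R M x := hR.imp .bot

theorem Recog.and (hR : Recog k R) (hS : Recog k S) :
    Recog k fun (M : Type) [Arith k M] (x : ι → M) => R M x ∧ S M x :=
  (hR.imp hS.not).not.congr fun _ _ _ => by tauto

theorem Recog.comap (f : ι → κ) (hR : Recog k R) :
    Recog k fun (M : Type) [Arith k M] (x : κ → M) => R M fun i => x (f i) := by
  obtain ⟨Q, _, A, hA⟩ := hR
  let B : DFA (κ → Fin k) Q := ⟨fun q a => A.step q (a ∘ f), A.start, A.accept⟩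
  refine ⟨Q, inferInstance, B, fun M _ x d hd hx => ?_⟩
  have : st A (x ∘ f) d = st B x d := by
    refine st_induction B x (I := fun d q => st A (x ∘ f) d = q) (fun q => ?_)
      pow_one' ?_ ?_ hd hd.one_le le_rfl
    · exact D0.st A (f := fun i _ _ => x (f i)) (fun i => .const (x (f i))) .arg _
    · simp only [st_one, B]
    · intro d hd _ _ h
      rw [st_mul A _ hd, h]
      rfl
  beta_reduce
  rw [hA M _ d hd fun i => hx (f i)]
  exact this ▸ Iff.rfl

/-- The state reached at `d` depends only on the digits below `d`. -/
theorem st_congr {M : Type} [Arith k M] {Q : Type} [Finite Q] (A : DFA (ι → Fin k) Q)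
    {x y : ι → M} {d : M} (hd : Pow d) (h : ∀ i, ∀ e < d, Pow e → dig (x i) e = dig (y i) e) :
    st A x d = st A y d := by
  refine st_induction A y (I := fun d q => st A x d = q) (fun q => ?_) pow_one' ?_ ?_ hd
    hd.one_le le_rfl
  · exact D0.st A (f := fun i _ _ => x i) (fun i => .const (x i)) .arg _
  · simp only [st_one]
  · intro e he _ hlt ih
    rw [st_mul A x he, ih]
    congr 1
    funext i
    exact h i e hlt he

/-- The subset automaton for `∃ y, R(x, y)`. Its state at `d` is the set of the states that `A` can
reach at `d` by a choice of the digits of `y` below `d`. As `y` may exceed `d`, a set is accepting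
if `A` can go from one of its elements to an accepting state by reading zeros for `x` and arbitrary
digits for `y`. -/
def subsetDFA {Q : Type} (A : DFA (Option ι → Fin k) Q) : DFA (ι → Fin k) (Set Q) where
  step S a := {q' | ∃ q ∈ S, ∃ b : Fin k, A.step q (cons b a) = q'}
  start := {A.start}
  accept := {S | ∃ q ∈ S, ∃ q' ∈ A.accept, Relation.ReflTransGen
    (fun p p' => ∃ a : Option ι → Fin k, (∀ i, (a (some i) : ℕ) = 0) ∧ A.step p a = p') q q'}

section Subset

variable {M : Type} [Arith k M] {Q : Type} [Finite Q] (A : DFA (Option ι → Fin k) Q)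

theorem st_cons_add {d : M} (hd : Pow d) {y : M} (hy : y < d) (x : ι → M) (b : Fin k) :
    st A (cons (y + (b : ℕ) • d) x) (k • d) = A.step (st A (cons y x) d) (cons b (digits x d)) := by
  have hb : dig (y + (b : ℕ) • d) d = b := by simpa using dig_eq hd hy b (.zero _)
  rw [st_mul A _ hd, digits_cons, hb]
  congr 1
  refine st_congr A hd fun o e he hp => ?_
  cases o with
  | none => exact dig_add_mult hp ((Mult.nsmul_self hd b.2).mono (hp.mul_le hd he)) y
  | some i => rfl

theorem mem_st_subsetDFA (x : ι → M) {d : M} (hd : Pow d) (q : Q) :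
    q ∈ st (subsetDFA A) x d ↔ ∃ y < d, st A (cons y x) d = q := by
  refine st_induction (subsetDFA A) x
    (I := fun d S => ∀ q, q ∈ S ↔ ∃ y < d, st A (cons y x) d = q) (fun S => ?_) pow_one' ?_ ?_ hd
    hd.one_le le_rfl q
  · refine .forall fun q => (D0.prop _).iff (.exLt .arg ?_)
    refine D0.st A (f := fun o _ w => cons (w (Fin.last 0)) x o) (fun o => ?_) .arg q
    cases o with
    | none => exact .var _
    | some i => exact .const (x i)
  · intro q
    simp only [st_one]
    exact ⟨fun h => ⟨0, one_pos', h.symm⟩, fun ⟨_, _, h⟩ => h.symm⟩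
  · intro d hd _ _ ih q
    constructor
    · rintro ⟨p, hp, b, rfl⟩
      obtain ⟨y, hy, rfl⟩ := (ih p).1 hp
      exact ⟨_, nsmul_add_lt hy b.2, st_cons_add A hd hy x b⟩
    · rintro ⟨y, hy, rfl⟩
      refine ⟨_, (ih _).2 ⟨low y d, low_lt hd y, rfl⟩, dig y d, ?_⟩
      rw [← st_cons_add A hd (low_lt hd y), ← low_mul hd, low_of_lt hd.mul hy]

/-- Every state that `A` visits above all entries of `x` is reached by a path of standard length:
the set of the states with that property is closed under the transitions. -/
theorem reachable_of_le (y : M) (x : ι → M) {d D : M} (hd : Pow d) (hD : Pow D) (hdD : d ≤ D)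
    (hx : ∀ i, x i < d) : Relation.ReflTransGen
      (fun p p' => ∃ a : Option ι → Fin k, (∀ i, (a (some i) : ℕ) = 0) ∧ A.step p a = p')
      (st A (cons y x) d) (st A (cons y x) D) := by
  refine st_induction A (cons y x) (I := fun _ q => Relation.ReflTransGen _ _ q)
    (fun q => .prop _) hd .refl ?_ hD hdD le_rfl
  intro e he hde _ h
  exact h.tail ⟨digits (cons y x) e, fun i => dig_of_lt he ((hx i).trans_le hde), rfl⟩

theorem exists_of_reachable (x : ι → M) {d : M} (hd : Pow d) (hx : ∀ i, x i < d) {y : M}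
    (hy : y < d) {q' : Q} (h : Relation.ReflTransGen
      (fun p p' => ∃ a : Option ι → Fin k, (∀ i, (a (some i) : ℕ) = 0) ∧ A.step p a = p')
      (st A (cons y x) d) q') :
    ∃ e, Pow e ∧ (∀ i, x i < e) ∧ ∃ z < e, st A (cons z x) e = q' := by
  induction h with
  | refl => exact ⟨d, hd, hx, y, hy, rfl⟩
  | tail _ h ih =>
    obtain ⟨e, he, hxe, z, hz, rfl⟩ := ih
    obtain ⟨a, ha, rfl⟩ := h
    refine ⟨k • e, he.mul, fun i => (hxe i).trans he.lt_mul, _, nsmul_add_lt hz (a none).2,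
      (st_cons_add A he hz x (a none)).trans ?_⟩
    congr 1
    funext o
    cases o with
    | none => rfl
    | some i => exact Fin.ext ((dig_of_lt he (hxe i)).trans (ha i).symm)

end Subset

/-- The automaton is `subsetDFA`. A witness `y` is split at `d`: its part below `d` picks a state in
the subset, and its part above `d` only needs a path in the finite transition graph. -/
theorem Recog.ex {R : ∀ (M : Type) [Arith k M], (ι → M) → M → Prop}
    (hR : Recog k fun (M : Type) [Arith k M] (w : Option ι → M) =>
      R M (fun i => w (some i)) (w none)) :
    Recog k fun (M : Type) [Arith k M] (x : ι → M) => ∃ y, R M x y := by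
  obtain ⟨Q, _, A, hA⟩ := hR
  refine ⟨Set Q, inferInstance, subsetDFA A, fun M _ x d hd hx => ?_⟩
  constructor
  · rintro ⟨y, hy⟩
    obtain ⟨D, hD, hlt⟩ := exists_pow_gt (d + y)
    have hdD : d ≤ D := le_self_add.trans hlt.le
    refine ⟨st A (cons y x) d, (mem_st_subsetDFA A x hd _).2 ⟨low y d, low_lt hd y, ?_⟩,
      st A (cons y x) D, ?_, reachable_of_le A y x hd hD hdD hx⟩
    · refine st_congr A hd fun o e he hp => ?_
      cases o with
      | none => exact dig_low hd hp he y
      | some i => rfl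
    · refine (hA M (cons y x) D hD fun o => ?_).1 hy
      cases o with
      | none => exact le_add_self.trans_lt hlt
      | some i => exact (hx i).trans_le hdD
  · rintro ⟨q, hq, q', hq', h⟩
    obtain ⟨y, hy, rfl⟩ := (mem_st_subsetDFA A x hd q).1 hq
    obtain ⟨e, he, hxe, z, hz, rfl⟩ := exists_of_reachable A x hd hx hy h
    refine ⟨z, (hA M (cons z x) e he fun o => ?_).2 hq'⟩
    cases o with
    | none => exact hz
    | some i => exact hxe i

end Recognizable

/-! ### Automata for addition and for `V_k` -/

section Atoms

variable {k : ℕ} {M : Type} [Arith k M] {n : ℕ}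

theorem add_nsmul_inj {d r r' : M} (hr : r < d) (hr' : r' < d) {a b : ℕ}
    (h : r + a • d = r' + b • d) : r = r' ∧ a = b := by
  wlog hab : a ≤ b generalizing r r' a b
  · exact (this hr' hr h.symm (by omega)).imp Eq.symm Eq.symm
  obtain ⟨c, rfl⟩ := Nat.exists_eq_add_of_le hab
  have e : r = r' + c • d := by
    refine add_right_cancel (b := a • d) (h.trans ?_)
    rw [add_nsmul, add_comm (a • d), add_assoc]
  rcases Nat.eq_zero_or_pos c with rfl | hc
  · exact ⟨by simpa using e, rfl⟩
  · have h1 : d ≤ r := calc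
      d = 1 • d := (one_nsmul d).symm
      _ ≤ c • d := nsmul_le_nsmul_left zero_le hc
      _ ≤ r := e ▸ le_add_self
    exact absurd hr h1.not_gt

/-- A remainder may be substituted into a bounded definable relation. -/
theorem D0.low_app {f g : M → (Fin n → M) → M} {R : M → (Fin n → M) → M → Prop} (hf : TF f)
    (hg : TF g) (hR : D0 fun d (w : Fin (n + 1) → M) => R d (Fin.init w) (w (Fin.last n))) :
    D0 fun d v => R d v (BuchiArith.low (f d v) (g d v)) := by
  refine (D0.exLe (R := fun d v b => BuchiArith.low (f d v) (g d v) = b ∧ R d v b) hf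
    ((D0.low hf.lift hg.lift (.var _)).and hR)).congr fun d v => ?_
  constructor
  · rintro ⟨_, _, rfl, h⟩
    exact h
  · intro h
    refine ⟨_, ?_, rfl, h⟩
    by_cases hp : Pow (g d v)
    · exact low_le hp _
    · rw [BuchiArith.low, dif_neg hp]
      exact zero_le

open Classical in
/-- The automaton for `x + y = z`. The state `some c` says that so far the sum is correct and that
the carry is `c`, the state `none` that it is not correct. -/
noncomputable def addDFA (k : ℕ) : DFA (Fin 3 → Fin k) (Option Bool) where
  step s a := s.bind fun c =>
    if (a 0 + a 1 + c.toNat : ℕ) = a 2 then some false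
    else if (a 0 + a 1 + c.toNat : ℕ) = a 2 + k then some true else none
  start := some false
  accept := {some false}

theorem addDFA_step {s : Option Bool} {a : Fin 3 → Fin k} {c' : Bool} (hk : 0 < k) :
    (addDFA k).step s a = some c' ↔
      ∃ c, s = some c ∧ (a 0 + a 1 + c.toNat : ℕ) = a 2 + c'.toNat * k := by
  cases s with
  | none => simp [addDFA]
  | some c =>
    simp only [addDFA, Option.bind_some, Option.some.injEq, exists_eq_left']
    cases c' <;> split_ifs <;> simp_all
    omega

/-- The carry at `d` is `c` iff `x + y = z + c d` for the remainders modulo `d`. -/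
theorem st_addDFA (x : Fin 3 → M) {d : M} (hd : Pow d) (c : Bool) :
    st (addDFA k) x d = some c ↔ low (x 0) d + low (x 1) d = low (x 2) d + c.toNat • d := by
  have hk := Arith.two_le (M := M)
  refine st_induction (addDFA k) x (I := fun d s => ∀ c, s = some c ↔
    low (x 0) d + low (x 1) d = low (x 2) d + c.toNat • d) (fun s => ?_) pow_one' ?_ ?_ hd
    hd.one_le le_rfl c
  · refine .forall fun c => (D0.prop _).iff ?_
    refine D0.low_app (R := fun d v u => u + low (x 1) d = low (x 2) d + c.toNat • d)
      (.const _) .arg ?_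
    refine D0.low_app (R := fun d v u => v (Fin.last 0) + u = low (x 2) d + c.toNat • d)
      (.const _) .arg ?_
    refine D0.low_app (R := fun d v u => Fin.init v (Fin.last 0) + v (Fin.last 1) =
      u + c.toNat • d) (.const _) .arg ?_
    exact .eq (.add (TF.var (Fin.last 0)).lift.lift (TF.var (Fin.last 1)).lift)
      (.add (.var _) (.nsmul _ .arg))
  · intro c
    rw [st_one]
    simp only [low_one, add_zero, zero_add]
    cases c
    · simp [addDFA]
    · simp [addDFA, one_pos'.ne]
  · intro d hd _ _ ih c'
    rw [addDFA_step (by omega)]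
    simp only [digits, low_mul hd]
    generalize (dig (x 0) d : ℕ) = a, (dig (x 1) d : ℕ) = b, (dig (x 2) d : ℕ) = e
    constructor
    · rintro ⟨c, hc, h⟩
      have := (ih c).1 hc
      calc low (x 0) d + a • d + (low (x 1) d + b • d)
          = (low (x 0) d + low (x 1) d) + (a + b) • d := by rw [add_nsmul]; abel
        _ = low (x 2) d + (a + b + c.toNat) • d := by rw [this, add_nsmul _ (a + b)]; abel
        _ = low (x 2) d + (e • d + c'.toNat • k • d) := by rw [h, add_nsmul, mul_nsmul']
        _ = _ := (add_assoc _ _ _).symm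
    · intro h
      have hlt : low (x 0) d + low (x 1) d < 2 • d := by
        rw [two_nsmul]
        exact add_lt_add (low_lt hd _) (low_lt hd _)
      obtain ⟨u, hu, r, hr, hsum⟩ := exists_eq_nsmul_add hlt
      have h1 : r + (a + b + u) • d = low (x 2) d + (e + c'.toNat * k) • d := by
        calc r + (a + b + u) • d = (u • d + r) + a • d + b • d := by rw [add_nsmul, add_nsmul]; abel
          _ = low (x 0) d + a • d + (low (x 1) d + b • d) := by rw [← hsum]; abel
          _ = low (x 2) d + (e + c'.toNat * k) • d := by
            rw [h, add_assoc, add_nsmul, mul_nsmul']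
      obtain ⟨rfl, h2⟩ := add_nsmul_inj hr (low_lt hd _) h1
      obtain ⟨c, rfl⟩ : ∃ c : Bool, c.toNat = u := by
        interval_cases u
        exacts [⟨false, rfl⟩, ⟨true, rfl⟩]
      exact ⟨c, (ih c).2 (hsum.trans (add_comm _ _)), h2⟩

open Classical in
/-- The automaton for `V_k(x) = y`. In the state `some false` both numbers are `0` so far; in the
state `some true` the lowest nonzero digit of `x` has been read, and `y` is correct so far. -/
noncomputable def valDFA (k : ℕ) : DFA (Fin 2 → Fin k) (Option Bool) where
  step s a := s.bind fun c =>
    if (a 1 : ℕ) = 0 ∧ (c = true ∨ (a 0 : ℕ) = 0) then some c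
    else if c = false ∧ (a 0 : ℕ) ≠ 0 ∧ (a 1 : ℕ) = 1 then some true else none
  start := some false
  accept := {some false, some true}

theorem V_add_nsmul {y d : M} (hd : Pow d) (hy : y < d) (hy0 : y ≠ 0) {a : ℕ} (ha : a < k) :
    V (y + a • d) = V y := by
  rcases Nat.eq_zero_or_pos a with rfl | h
  · rw [zero_nsmul, add_zero]
  · refine Arith.V_add y _ (pos_iff_ne_zero.2 hy0) (nsmul_pos hd.1 h.ne') ?_
    rw [Arith.V_digit d hd a h ha]
    exact (V_le y).trans_lt hy

theorem st_valDFA (x : Fin 2 → M) {d : M} (hd : Pow d) :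
    (st (valDFA k) x d = some false ↔ low (x 0) d = 0 ∧ low (x 1) d = 0) ∧
    (st (valDFA k) x d = some true ↔ low (x 0) d ≠ 0 ∧ V (low (x 0) d) = low (x 1) d) := by
  refine st_induction (valDFA k) x (I := fun d s =>
    (s = some false ↔ low (x 0) d = 0 ∧ low (x 1) d = 0) ∧
    (s = some true ↔ low (x 0) d ≠ 0 ∧ V (low (x 0) d) = low (x 1) d))
    (fun s => ?_) pow_one' ?_ ?_ hd hd.one_le le_rfl
  · have h0 (i : Fin 2) : D0 fun d (_ : Fin 0 → M) => low (x i) d = 0 :=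
      .low (.const _) .arg (.const 0)
    refine ((D0.prop _).iff ((h0 0).and (h0 1))).and ((D0.prop _).iff ((h0 0).not.and ?_))
    refine D0.low_app (R := fun d v u => V u = low (x 1) d) (.const _) .arg ?_
    exact D0.low_app (R := fun d v u => V (v (Fin.last 0)) = u) (.const _) .arg
      (.eq (TF.var (Fin.last 0)).lift.V (.var _))
  · rw [st_one]
    simp [low_one, valDFA]
  · rintro d hd _ _ ⟨ih0, ih1⟩
    simp only [low_mul hd]
    set s := st (valDFA k) x d
    have hX := low_lt hd (x 0)
    have hY := low_lt hd (x 1)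
    have ha : (dig (x 0) d : ℕ) < k := (dig (x 0) d).2
    set X := low (x 0) d
    set Y := low (x 1) d
    have hz : ∀ a : ℕ, a • d = 0 ↔ a = 0 := fun a =>
      ⟨fun h => nsmul_cancel hd.1 (h.trans (zero_nsmul d).symm), fun h => by rw [h, zero_nsmul]⟩
    have hstep : (valDFA k).step s (digits x d) = s.bind fun c =>
        if (dig (x 1) d : ℕ) = 0 ∧ (c = true ∨ (dig (x 0) d : ℕ) = 0) then some c
        else if c = false ∧ (dig (x 0) d : ℕ) ≠ 0 ∧ (dig (x 1) d : ℕ) = 1 then some true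
        else none := rfl
    rw [hstep]
    generalize (dig (x 0) d : ℕ) = a, (dig (x 1) d : ℕ) = b at ha ⊢
    simp only [add_eq_zero, hz, ne_eq]
    by_cases hX0 : X = 0
    · simp only [hX0, true_and, zero_add] at ih0 ih1 ⊢
      have hV : a ≠ 0 → (V (a • d) = Y + b • d ↔ Y = 0 ∧ b = 1) := by
        intro h
        rw [Arith.V_digit d hd a (by omega) ha]
        constructor
        · intro h
          have := add_nsmul_inj hd.1 hY (a := 1) (b := b) (by rwa [zero_add, one_nsmul])
          exact ⟨this.1.symm, this.2.symm⟩
        · rintro ⟨h1, h2⟩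
          rw [h1, h2, zero_add, one_nsmul]
      rcases s with _ | _ | _
      · have hY0 : Y ≠ 0 := by simpa using ih0
        simp +contextual [hY0, hV]
      · have hY0 : Y = 0 := by simpa using ih0
        simp only [hY0, true_and] at hV ⊢
        by_cases ha0 : a = 0
        · by_cases hb : b = 0 <;> simp [ha0, hb]
        · rw [hV ha0]
          by_cases hb : b = 1 <;> simp [ha0, hb]
      · exact absurd rfl (ih1.1 rfl).1
    · simp only [hX0, false_and, iff_false, not_false_eq_true, true_and] at ih0 ih1 ⊢
      rw [V_add_nsmul hd hX hX0 ha]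
      have hV : V X = Y + b • d ↔ V X = Y ∧ b = 0 := by
        constructor
        · intro h
          have := add_nsmul_inj ((V_le X).trans_lt hX) hY (a := 0) (b := b)
            (by rwa [zero_nsmul, add_zero])
          exact ⟨this.1, this.2.symm⟩
        · rintro ⟨h1, h2⟩
          rw [h1, h2, zero_nsmul, add_zero]
      rw [hV]
      rcases s with _ | _ | _
      · have h1 : V X ≠ Y := by simpa [hX0] using ih1
        simp [h1]
      · exact absurd rfl ih0
      · have h1 : V X = Y := by simpa [hX0] using ih1
        by_cases hb : b = 0 <;> simp [h1, hb]

end Atoms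

/-! ### Recognizability of formulas -/

section Terms

variable {k : ℕ} {ι : Type} [Finite ι]

theorem Recog.add (i j l : ι) : Recog k fun (M : Type) [Arith k M] (x : ι → M) =>
    x i + x j = x l := by
  have : Recog k fun (M : Type) [Arith k M] (x : Fin 3 → M) => x 0 + x 1 = x 2 := by
    refine ⟨_, inferInstance, addDFA k, fun M _ x d hd hx => ?_⟩
    have := st_addDFA x hd false
    rw [low_of_lt hd (hx 0), low_of_lt hd (hx 1), low_of_lt hd (hx 2)] at this
    simpa [addDFA] using this.symm
  exact this.comap ![i, j, l]

theorem Recog.val (i j : ι) : Recog k fun (M : Type) [Arith k M] (x : ι → M) =>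
    V (x i) = x j := by
  have : Recog k fun (M : Type) [Arith k M] (x : Fin 2 → M) => V (x 0) = x 1 := by
    refine ⟨_, inferInstance, valDFA k, fun M _ x d hd hx => ?_⟩
    have := st_valDFA x hd
    rw [low_of_lt hd (hx 0), low_of_lt hd (hx 1)] at this
    have h : st (valDFA k) x d ∈ (valDFA k).accept ↔
      st (valDFA k) x d = some false ∨ st (valDFA k) x d = some true := Iff.rfl
    rw [h, this.1, this.2]
    beta_reduce
    constructor
    · intro h
      by_cases h0 : x 0 = 0
      · rw [h0, Arith.V_zero] at h
        exact .inl ⟨h0, h.symm⟩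
      · exact .inr ⟨h0, h⟩
    · rintro (⟨h, h'⟩ | ⟨_, h⟩)
      · rw [h, h', Arith.V_zero]
      · exact h
  exact this.comap ![i, j]

theorem Recog.zero (i : ι) : Recog k fun (M : Type) [Arith k M] (x : ι → M) => x i = 0 :=
  (Recog.add i i i).congr fun _ _ _ => add_eq_left

theorem Recog.eq (i j : ι) : Recog k fun (M : Type) [Arith k M] (x : ι → M) => x i = x j := by
  refine (Recog.ex (R := fun M _ x z => z = 0 ∧ x i + z = x j)
    ((Recog.zero none).and (.add (some i) none (some j)))).congr fun M _ x => ?_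
  simp

theorem Recog.le (i j : ι) : Recog k fun (M : Type) [Arith k M] (x : ι → M) => x i ≤ x j := by
  refine (Recog.ex (R := fun M _ x z => x i + z = x j)
    (.add (some i) none (some j))).congr fun M _ x => ?_
  rw [le_iff_exists_add]
  exact exists_congr fun _ => eq_comm

theorem Recog.one (i : ι) : Recog k fun (M : Type) [Arith k M] (x : ι → M) => x i = 1 := by
  refine ((Recog.zero i).not.and (Recog.ex (R := fun M _ x z => ¬ z = 0 ∧ ¬ x i ≤ z)
    ((Recog.zero none).not.and (Recog.le (some i) none).not)).not).congr fun M _ x => ?_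
  constructor
  · rintro ⟨h, h'⟩
    push Not at h'
    exact le_antisymm (h' 1 one_pos'.ne') (one_le_of_pos (pos_iff_ne_zero.2 h))
  · intro h
    rw [h]
    refine ⟨one_pos'.ne', ?_⟩
    rintro ⟨z, hz, hz'⟩
    exact hz' (one_le_of_pos (pos_iff_ne_zero.2 hz))

/-- The graph of a term. -/
theorem Recog.term (t : LBA.Term ι) : Recog k fun (M : Type) [Arith k M] (w : Option ι → M) =>
    t.realize (fun i => w (some i)) = w none := by
  induction t with
  | var i => exact .eq (some i) none
  | func f ts ih =>
    -- The value of the subterm `ts i` becomes a new variable; `some none` is the value of the term.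
    have sub (κ : Type) [Finite κ] (g : Option ι → κ) (i) :
        Recog k fun (M : Type) [Arith k M] (w : κ → M) =>
          (ts i).realize (fun j => w (g (some j))) = w (g none) := (ih i).comap g
    cases f with
    | zero => exact (Recog.zero none).congr fun M _ w => eq_comm
    | succ =>
      refine (Recog.ex (R := fun M _ w u => (ts 0).realize (fun j => w (some j)) = u ∧
        ∃ v, v = 1 ∧ u + v = w none) ((sub _ (fun o => o.elim none (some ∘ some)) 0).and
          (Recog.ex (R := fun M _ w v => v = 1 ∧ w none + v = w (some none))
            ((Recog.one none).and (.add (some none) none (some (some none))))))).congr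
        fun M _ w => ?_
      simp only [exists_eq_left, exists_eq_left']
      exact Iff.rfl
    | add =>
      refine (Recog.ex (R := fun M _ w u => (ts 0).realize (fun j => w (some j)) = u ∧
        ∃ v, (ts 1).realize (fun j => w (some j)) = v ∧ u + v = w none)
          ((sub _ (fun o => o.elim none (some ∘ some)) 0).and
          (Recog.ex (R := fun M _ w v => (ts 1).realize (fun j => w (some (some j))) = v ∧
            w none + v = w (some none))
            ((sub _ (fun o => o.elim none (some ∘ some ∘ some)) 1).and
              (.add (some none) none (some (some none))))))).congr fun M _ w => ?_
      simp only [exists_eq_left']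
      exact Iff.rfl
    | V =>
      refine (Recog.ex (R := fun M _ w u => (ts 0).realize (fun j => w (some j)) = u ∧
        V u = w none) ((sub _ (fun o => o.elim none (some ∘ some)) 0).and
          (.val none (some none)))).congr fun M _ w => ?_
      simp only [exists_eq_left']
      exact Iff.rfl

theorem Recog.rel₂ {R : ∀ (M : Type) [Arith k M], M → M → Prop}
    (hR : Recog k fun (M : Type) [Arith k M] (x : Fin 2 → M) => R M (x 0) (x 1))
    (t u : LBA.Term ι) : Recog k fun (M : Type) [Arith k M] (x : ι → M) =>
      R M (t.realize x) (u.realize x) := by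
  refine (Recog.ex (R := fun M _ x y => t.realize x = y ∧ ∃ z, u.realize x = z ∧ R M y z)
    ((Recog.term t).and (Recog.ex (R := fun M _ x z =>
      u.realize (fun i => x (some i)) = z ∧ R M (x none) z)
      (((Recog.term u).comap fun o => o.elim none (some ∘ some)).and
        (hR.comap ![some none, none]))))).congr fun M _ x => ?_
  simp only [exists_eq_left']

/-- By induction on the formula: every relation definable in Büchi arithmetic is recognizable. -/
theorem recog_formula {α : Type} [Finite α] {n : ℕ} (φ : LBA.BoundedFormula α n) :
    Recog k fun (M : Type) [Arith k M] (x : α ⊕ Fin n → M) =>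
      φ.Realize (fun i => x (.inl i)) (fun i => x (.inr i)) := by
  have hx {M : Type} {n : ℕ} (x : α ⊕ Fin n → M) :
      Sum.elim (fun i => x (.inl i)) (fun i => x (.inr i)) = x := Sum.elim_comp_inl_inr x
  induction φ with
  | falsum => exact .bot
  | equal t u =>
    refine (Recog.rel₂ (R := fun M _ a b => a = b) (.eq 0 1) t u).congr fun M _ x => ?_
    refine Iff.trans ?_ (BoundedFormula.realize_bdEqual t u).symm
    rw [hx]
  | rel r ts =>
    cases r
    refine (Recog.rel₂ (R := fun M _ a b => a ≤ b) (.le 0 1) (ts 0) (ts 1)).congr fun M _ x => ?_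
    refine Iff.trans ?_ BoundedFormula.realize_rel.symm
    rw [hx]
    exact Iff.rfl
  | imp _ _ ih ih' => exact ih.imp ih'
  | @all n φ ih =>
    let f : α ⊕ Fin (n + 1) → Option (α ⊕ Fin n) :=
      Sum.elim (some ∘ .inl) (Fin.lastCases none (some ∘ .inr))
    refine (Recog.ex (R := fun M _ x y => ¬ φ.Realize (fun i => x (.inl i))
      (Fin.snoc (fun i => x (.inr i)) y)) ((ih.comap f).not.congr fun M _ w => ?_)).not.congr
      fun M _ x => ?_
    · refine not_congr (iff_of_eq ?_)
      congr 1
      funext i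
      cases i using Fin.lastCases <;> simp [f]
    · rw [not_exists_not]
      exact Iff.rfl

end Terms

/-! ### The formulas `W_{A,q}(x, g(x))` in models of `T_k` -/

section AtG

variable {k m : ℕ} {M : Type} [Arith k M]

/-- The meaning of the formula `g(x) = d`. -/
def IsG (x : Fin m → M) (d : M) : Prop :=
  ((∀ i, x i = 0) ∧ d = 1) ∨ (Pow d ∧ ∃ i, (∀ j, x j ≤ x i) ∧ x i < d ∧ d ≤ k • x i)

theorem realize_WAtG {Q : Type} [Finite Q] (A : DFA (Fin m → Fin k) Q) (q : Q) (x : Fin m → M) :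
    (WAtG A q).Realize x ↔ ∃ d ≤ 1 + k • ∑ i, x i, IsG x d ∧ Run A x d q := by
  simp only [WAtG, Formula.Realize, realize_exLe, BoundedFormula.realize_inf, realize_W, gEq,
    BoundedFormula.realize_sup, BoundedFormula.realize_iInf, BoundedFormula.realize_iSup,
    BoundedFormula.realize_bdEqual, Term.realize_le, Term.realize_lt, realize_isPow, realize_fv,
    realize_new, realize_tZero, realize_numeral, realize_nMul, realize_tAdd, realize_tSum,
    one_nsmul, IsG]

theorem IsG.pow {x : Fin m → M} {d : M} (h : IsG x d) : Pow d ∧ ∀ i, x i < d := by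
  rcases h with ⟨h, rfl⟩ | ⟨hd, i, h, hi, _⟩
  · exact ⟨pow_one', fun i => h i ▸ one_pos'⟩
  · exact ⟨hd, fun j => (h j).trans_lt hi⟩

theorem exists_isG (x : Fin m → M) : ∃ d ≤ 1 + k • ∑ i, x i, IsG x d := by
  by_cases h : ∀ i, x i = 0
  · exact ⟨1, le_self_add, .inl ⟨h, rfl⟩⟩
  · push Not at h
    obtain ⟨j, hj⟩ := h
    have : Nonempty (Fin m) := ⟨j⟩
    obtain ⟨i, hi⟩ := Finite.exists_max x
    obtain ⟨d, hd, hle, hlt⟩ := Arith.V_log (x i) ((pos_iff_ne_zero.2 hj).trans_le (hi j))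
    have hdx : k • d ≤ k • x i := nsmul_le_nsmul_right hle k
    refine ⟨k • d, hdx.trans (le_trans (nsmul_le_nsmul_right ?_ k) le_add_self),
      .inr ⟨hd.mul, i, hi, hlt, hdx⟩⟩
    exact Finset.single_le_sum (fun _ _ => zero_le) (Finset.mem_univ i)

end AtG

/-- One automaton describes the meaning of `φ` in all the models of `T_k` at once. -/
theorem exists_automaton {k m : ℕ} (φ : LBA.Formula (Fin m)) :
    ∃ (Q : Type) (_ : Finite Q) (A : DFA (Fin m → Fin k) Q),
      ∀ (M : Type) [Arith k M] (x : Fin m → M),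
        φ.Realize x ↔ ∃ q : {q : Q // q ∈ A.accept}, (WAtG A q).Realize x := by
  obtain ⟨Q, hQ, A, hA⟩ := (recog_formula (k := k) φ).comap (Sum.elim id Fin.elim0)
  refine ⟨Q, hQ, A, fun M _ x => ?_⟩
  have hφ : φ.Realize x ↔ BoundedFormula.Realize φ (fun i => x (Sum.elim id Fin.elim0 (.inl i)))
      (fun i => x (Sum.elim id Fin.elim0 (.inr i))) := by
    rw [Formula.Realize, Subsingleton.elim (default : Fin 0 → M)]
    exact Iff.rfl
  simp only [realize_WAtG]
  rw [hφ]
  constructor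
  · intro h
    obtain ⟨d, hd, hg⟩ := exists_isG x
    exact ⟨⟨_, (hA M x d hg.pow.1 hg.pow.2).1 h⟩, d, hd, hg, (st_eq_iff A x hg.pow.1 _).1 rfl⟩
  · rintro ⟨⟨q, hq⟩, d, _, hg, hr⟩
    rw [← st_eq_iff A x hg.pow.1] at hr
    exact (hA M x d hg.pow.1 hg.pow.2).2 (hr ▸ hq)

theorem models_univClosure {k : ℕ} (hk : 2 ≤ k) {m : ℕ} {ψ : LBA.Formula (Fin m)}
    (h : ∀ (M : Type) [Arith k M] (x : Fin m → M), ψ.Realize x) : T k ⊨ᵇ univClosure ψ := by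
  have key : ∀ (M : Type) [LBA.Structure M], M ⊨ T k → M ⊨ univClosure ψ := by
    intro M s hM
    obtain ⟨_, rfl⟩ := exists_arith hk hM
    exact realize_univClosure.2 (h M)
  exact Theory.models_sentence_iff.2 fun M => key M M.is_model

end BuchiArith

theorem mainTheorem2 (k : ℕ) (hk : 2 ≤ k) (m : ℕ) (φ : BuchiArith.LBA.Formula (Fin m)) :
    ∃ (Q : Type) (_ : Finite Q) (A : DFA (Fin m → Fin k) Q),
      BuchiArith.T k ⊨ᵇ BuchiArith.univClosure
        (φ.iff (FirstOrder.Language.Formula.iSup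
          fun q : {q : Q // q ∈ A.accept} => BuchiArith.WAtG A q)) := by
  obtain ⟨Q, hQ, A, hA⟩ := BuchiArith.exists_automaton (k := k) φ
  refine ⟨Q, hQ, A, BuchiArith.models_univClosure hk fun M _ x => ?_⟩
  rw [FirstOrder.Language.Formula.realize_iff, FirstOrder.Language.Formula.realize_iSup]
  exact hA M x
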